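/- Let $\mathbb K$ be an algebraically closed field of characteristic zero and let $X$ be a smooth algebraic variety over $\mathbb K$ (reduced, irreducible, separated and of finite type). A spray of rank $r$ over $X$ is a triple $(E,p,s)$ consisting of an algebraic vector bundle $p\colon E\to X$ of rank $r$ and a morphism $s\colon E\to X$ such that $s|_Z=p|_Z$, where $Z\subset E$ is the zero section of $p$. The spray is dominating if for every $x\in X$ the differential $d(s|_{E_x})\colon T_{0_x}E_x\to T_xX$ of the restriction of $s$ to the fibre $E_x=p^{-1}(x)$ at the origin $0_x$ is surjective. A finite family of sprays $(E_i,p_i,s_i)$ over $X$ is dominating if $T_xX=\sum_i ds_i(T_{0_{i,x}}E_{i,x})$ for every $x\in X$. The composition of two sprays $(E_1,p_1,s_1)$ and $(E_2,p_2,s_2)$ over $X$ is the triple $(E_1*E_2,\,p_1*p_2,\,s_1*s_2)$ with $$E_1*E_2=\{(e_1,e_2)\in E_1\times E_2 \mid s_1(e_1)=p_2(e_2)\}=s_1^*(E_2),\qquad (p_1*p_2)(e_1,e_2)=p_1(e_1),\qquad (s_1*s_2)(e_1,e_2)=s_2(e_2),$$ together with the section $\sigma(x)=(0_{1,x},0_{2,x})$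 of $p_1*p_2$. The same formulas define the composition of arbitrary triples $(E,p,s)$ with a distinguished section of $p$ along which $s$ and $p$ agree, and hence, by iteration (bracketing to the left), the composition $E_1*\dots*E_m$ of a finite sequence of sprays. Such a triple is called a spray of rank $r$ if $p\colon E\to X$ admits the structure of an algebraic vector bundle of rank $r$ whose zero section is the distinguished section. Then the following hold. 1. If $(E_1,p_1,s_1)$ is a spray of rank $r$ over $X$ and $(E_2,p_2,s_2)$ is a spray of rank $1$ over $X$, then the composition $(E_1*E_2,\,p_1*p_2,\,s_1*s_2)$ is a spray of rank $r+1$ over $X$. 2. The composition $(E,p,s)$ of $r$ sprays $(L_i,q_i,s_i)$, $i=1,\dots,r$, of rank $1$ over $X$ is a spray of rank $r$ over $X$. If, moreover, the family $(L_i,q_i,s_i)_{i=1,\dots,r}$ is dominating, then the spray $(E,p,s)$ is dominating. -/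

import Mathlib

open CategoryTheory CategoryTheory.Limits AlgebraicGeometry

universe u

noncomputable section

namespace AlgSpray

/-! ### Vector bundles -/

/-- A structure of algebraic vector bundle of rank `r` on the morphism `p : E ⟶ X`, with zero
section `zero`: an open cover `U i` of `X` together with fibre coordinates
`t i 1, …, t i r` on `p⁻¹(U i)` which identify `p⁻¹(U i)` with `U i × 𝔸ʳ` over `U i`, such that
the transition maps are given by invertible matrices of functions on `U i ∩ U j`, and such that
the fibre coordinates vanish on the zero section. -/
structure VectorBundleStructure {E X : Scheme.{u}} (p : E ⟶ X) (zero : X ⟶ E) (r : ℕ) where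
  /-- the index set of the trivializing cover -/
  ι : Type u
  /-- the trivializing open subsets -/
  U : ι → X.Opens
  iSup_U : ⨆ i, U i = ⊤
  /-- the fibre coordinates -/
  t : ∀ i, Fin r → Γ(E, p ⁻¹ᵁ U i)
  isIso_chart : ∀ i, IsIso
    (AffineSpace.homOfVector (n := ULift.{u} (Fin r)) (p ∣_ U i)
      (fun k => (p ⁻¹ᵁ U i).topIso.inv (t i k.down)))
  /-- the transition matrices -/
  g : ∀ i j, Matrix.GeneralLinearGroup (Fin r) Γ(X, U i ⊓ U j)
  transition : ∀ i j k,
    E.presheaf.map (homOfLE (p.preimage_mono inf_le_right)).op (t j k) =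
      ∑ l, p.app (U i ⊓ U j) ((g i j : Matrix (Fin r) (Fin r) Γ(X, U i ⊓ U j)) k l) *
        E.presheaf.map (homOfLE (p.preimage_mono inf_le_left)).op (t i l)
  zero_proj : zero ≫ p = 𝟙 X
  zero_coord : ∀ i k, zero.app (p ⁻¹ᵁ U i) (t i k) = 0

/-! ### Tangent spaces at rational points -/

section Tangent

variable {K : Type u} [Field K]

/-- The `K`-rational points of a `K`-scheme `f : X ⟶ Spec K`. If `K` is algebraically closed and
`X` is locally of finite type, these are the closed points of `X`
(`AlgebraicGeometry.pointEquivClosedPoint`), i.e. the points of `X` as a classical variety. -/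
structure KPoint {X : Scheme.{u}} (f : X ⟶ Spec (.of K)) where
  /-- the point as a morphism -/
  hom : Spec (.of K) ⟶ X
  hom_comp : hom ≫ f = 𝟙 _

namespace KPoint

variable {X Y : Scheme.{u}} {fX : X ⟶ Spec (.of K)} {fY : Y ⟶ Spec (.of K)}

/-- The underlying point of the scheme. -/
def pt (x : KPoint fX) : X := x.hom (IsLocalRing.closedPoint K)

/-- The local ring of `X` at `x`. -/
def LocalRing (x : KPoint fX) : Type u := X.presheaf.stalk x.pt

instance (x : KPoint fX) : CommRing x.LocalRing :=
  inferInstanceAs (CommRing (X.presheaf.stalk x.pt))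

/-- The structure map from `K` to the local ring at `x`. -/
def const (x : KPoint fX) : K →+* x.LocalRing :=
  ((Scheme.ΓSpecIso (.of K)).inv ≫ fX.appTop ≫ X.presheaf.germ ⊤ x.pt (TopologicalSpace.Opens.mem_top _)).hom

instance (x : KPoint fX) : Algebra K x.LocalRing := x.const.toAlgebra

/-- Evaluation of germs of functions at `x`. -/
def eval (x : KPoint fX) : x.LocalRing →+* K := (Scheme.stalkClosedPointTo x.hom).hom

/-- The field `K`, regarded as a module over the local ring at `x` through evaluation at `x`. -/
@[nolint unusedArguments]
def Residue (_ : KPoint fX) : Type u := K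

instance (x : KPoint fX) : AddCommGroup x.Residue := inferInstanceAs (AddCommGroup K)

instance (x : KPoint fX) : Module K x.Residue := inferInstanceAs (Module K K)

instance (x : KPoint fX) : Module x.LocalRing x.Residue := Module.compHom K x.eval

lemma smul_def (x : KPoint fX) (a : x.LocalRing) (c : x.Residue) :
    a • c = (show x.Residue from (x.eval a * (show K from c) : K)) := rfl

instance (x : KPoint fX) : SMulCommClass x.LocalRing K x.Residue where
  smul_comm a c d := by
    change (x.eval a * (c * (show K from d)) : K) = c * (x.eval a * (show K from d))
    ring

instance (x : KPoint fX) : SMulCommClass K x.LocalRing x.Residue := SMulCommClass.symm _ _ _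

/-- The Zariski tangent space of `X` at `x`: the `K`-linear derivations of the local ring at `x`
with values in `K`. -/
abbrev TangentSpace (x : KPoint fX) : Type u := Derivation K x.LocalRing x.Residue

/-- Pullback of germs along a `K`-morphism `g` which maps the point `y` to the point `x`. -/
def pullbackGerm (y : KPoint fY) (x : KPoint fX) (g : Y ⟶ X) (hg : y.hom ≫ g = x.hom) :
    x.LocalRing →+* y.LocalRing :=
  (X.presheaf.stalkSpecializes (x := g y.pt) (y := x.pt)
    (by rw [pt, pt, ← hg]; exact specializes_rfl) ≫ g.stalkMap y.pt).hom

lemma pullbackGerm_const (y : KPoint fY) (x : KPoint fX) (g : Y ⟶ X) (hg : y.hom ≫ g = x.hom)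
    (hK : g ≫ fX = fY) (c : K) : pullbackGerm y x g hg (x.const c) = y.const c := by
  subst hK
  have h : (fX.appTop ≫ X.presheaf.germ ⊤ x.pt (TopologicalSpace.Opens.mem_top _)) ≫
      (X.presheaf.stalkSpecializes (x := g y.pt) (y := x.pt)
        (by rw [pt, pt, ← hg]; exact specializes_rfl) ≫ g.stalkMap y.pt) =
      (g ≫ fX).appTop ≫ Y.presheaf.germ ⊤ y.pt (TopologicalSpace.Opens.mem_top _) := by
    rw [Category.assoc, TopCat.Presheaf.germ_stalkSpecializes_assoc, Scheme.Hom.germ_stalkMap]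
    rfl
  exact congrArg (fun φ => φ.hom ((Scheme.ΓSpecIso (.of K)).inv.hom c)) h

lemma eval_pullbackGerm (y : KPoint fY) (x : KPoint fX) (g : Y ⟶ X) (hg : y.hom ≫ g = x.hom)
    (a : x.LocalRing) : y.eval (pullbackGerm y x g hg a) = x.eval a := by
  obtain ⟨x, hx⟩ := x
  change y.hom ≫ g = x at hg
  subst hg
  have h : X.presheaf.stalkSpecializes (x := g y.pt) (y := g y.pt) specializes_rfl ≫
      g.stalkMap y.pt ≫ Scheme.stalkClosedPointTo y.hom =
      Scheme.stalkClosedPointTo (y.hom ≫ g) := by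
    rw [Scheme.stalkClosedPointTo_comp, TopCat.Presheaf.stalkSpecializes_refl]
    exact Category.id_comp _
  exact congrArg (fun φ => φ.hom a) h

/-- The differential at `y` of a `K`-morphism `g : Y ⟶ X` which maps the point `y` to the
point `x`: it sends the derivation `D` to `D ∘ g^*`. -/
def differential (y : KPoint fY) (x : KPoint fX) (g : Y ⟶ X) (hg : y.hom ≫ g = x.hom)
    (hK : g ≫ fX = fY) : y.TangentSpace →ₗ[K] x.TangentSpace where
  toFun D := Derivation.mk'
    { toFun := fun a => D (pullbackGerm y x g hg a)
      map_add' := fun a b => by rw [map_add, map_add]; rfl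
      map_smul' := fun c a => by
        have : pullbackGerm y x g hg (c • a) = c • pullbackGerm y x g hg a := by
          rw [Algebra.smul_def, Algebra.smul_def, map_mul]
          exact congrArg (· * _) (pullbackGerm_const y x g hg hK c)
        rw [this, D.map_smul]; rfl }
    (fun a b => by
      change D (pullbackGerm y x g hg (a * b)) = _
      rw [map_mul, D.leibniz]
      simp only [smul_def, eval_pullbackGerm]
      rfl)
  map_add' _ _ := rfl
  map_smul' _ _ := rfl

end KPoint

end Tangent

/-! ### Sprays -/

section Spray

variable {K : Type u} [Field K] {X : Scheme.{u}}

/-- A triple `(E, p, s)` over the `K`-scheme `X`, consisting of `K`-morphisms `p, s : E ⟶ X`,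
together with a section `zero` of `p` such that `s` and `p` agree on `zero(X)`. There is no
vector bundle structure here: such triples are what one gets by composing sprays. The
`K`-structure of `E` is the one given by `p`. -/
structure Triple (f : X ⟶ Spec (.of K)) where
  /-- the total space -/
  E : Scheme.{u}
  /-- the projection -/
  p : E ⟶ X
  /-- the spray map -/
  s : E ⟶ X
  /-- the distinguished section of `p` -/
  zero : X ⟶ E
  zero_p : zero ≫ p = 𝟙 X
  zero_s : zero ≫ s = zero ≫ p
  s_over : s ≫ f = p ≫ f

namespace Triple

variable {f : X ⟶ Spec (.of K)}

/-- `(E, p, s)` is a spray of rank `r`: `p` is a vector bundle of rank `r` with the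
distinguished section as its zero section (so that `s` and `p` agree on the zero section). -/
def IsSpray (S : Triple f) (r : ℕ) : Prop :=
  Nonempty (VectorBundleStructure S.p S.zero r)

/-- The composition `E₁ * E₂ = {(e₁, e₂) | s₁ e₁ = p₂ e₂} = s₁^* E₂`, with projection
`(e₁, e₂) ↦ p₁ e₁`, spray map `(e₁, e₂) ↦ s₂ e₂` and section `x ↦ (0₁ x, 0₂ x)`. -/
def comp (S₁ S₂ : Triple f) : Triple f where
  E := pullback S₁.s S₂.p
  p := pullback.fst S₁.s S₂.p ≫ S₁.p
  s := pullback.snd S₁.s S₂.p ≫ S₂.s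
  zero := pullback.lift S₁.zero S₂.zero (by rw [S₁.zero_s, S₁.zero_p, S₂.zero_p])
  zero_p := by rw [pullback.lift_fst_assoc, S₁.zero_p]
  zero_s := by
    rw [pullback.lift_fst_assoc, pullback.lift_snd_assoc, S₁.zero_p, S₂.zero_s, S₂.zero_p]
  s_over := by
    rw [Category.assoc, S₂.s_over, ← pullback.condition_assoc, S₁.s_over, Category.assoc]

/-- The trivial triple `(X, id, id)`: the composition of the empty sequence. -/
def unit (f : X ⟶ Spec (.of K)) : Triple f where
  E := X
  p := 𝟙 X
  s := 𝟙 X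
  zero := 𝟙 X
  zero_p := Category.comp_id _
  zero_s := rfl
  s_over := rfl

/-- The iterated composition `E₁ * ⋯ * Eₘ` of a finite sequence, bracketed to the left. -/
def iterComp : (m : ℕ) → (Fin m → Triple f) → Triple f
  | 0, _ => unit f
  | 1, S => S 0
  | m + 2, S => (iterComp (m + 1) (fun i => S i.castSucc)).comp (S (Fin.last (m + 1)))

/-- The fibre `E_x` of `p : E ⟶ X` over the point `x`. -/
abbrev fibre (S : Triple f) (x : KPoint f) : Scheme.{u} := pullback S.p x.hom

/-- The structure map of the `K`-scheme `E_x`. -/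
def fibreStr (S : Triple f) (x : KPoint f) : S.fibre x ⟶ Spec (.of K) := pullback.snd S.p x.hom

/-- The origin `0_x` of the fibre `E_x`. -/
def origin (S : Triple f) (x : KPoint f) : KPoint (S.fibreStr x) where
  hom := pullback.lift (x.hom ≫ S.zero) (𝟙 _) (by
    rw [Category.assoc, S.zero_p, Category.comp_id, Category.id_comp])
  hom_comp := pullback.lift_snd _ _ _

/-- The restriction `s|_{E_x} : E_x ⟶ X` of the spray map to the fibre over `x`. -/
def fibreMap (S : Triple f) (x : KPoint f) : S.fibre x ⟶ X := pullback.fst S.p x.hom ≫ S.s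

lemma fibreMap_over (S : Triple f) (x : KPoint f) : S.fibreMap x ≫ f = S.fibreStr x := by
  change (pullback.fst S.p x.hom ≫ S.s) ≫ f = pullback.snd S.p x.hom
  rw [Category.assoc, S.s_over, pullback.condition_assoc, x.hom_comp, Category.comp_id]

lemma origin_fibreMap (S : Triple f) (x : KPoint f) :
    (S.origin x).hom ≫ S.fibreMap x = x.hom := by
  change pullback.lift (x.hom ≫ S.zero) (𝟙 _) _ ≫ pullback.fst S.p x.hom ≫ S.s = x.hom
  rw [pullback.lift_fst_assoc, Category.assoc, S.zero_s, S.zero_p, Category.comp_id]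

/-- The differential `T_{0_x} E_x → T_x X` of `s|_{E_x}` at the origin. -/
def fibreDifferential (S : Triple f) (x : KPoint f) :
    (S.origin x).TangentSpace →ₗ[K] x.TangentSpace :=
  (S.origin x).differential x (S.fibreMap x) (S.origin_fibreMap x) (S.fibreMap_over x)

/-- `(E, p, s)` is dominating: for every `x ∈ X` the map `s|_{E_x} : E_x ⟶ X` is dominant
(submersive) at the origin. -/
def IsDominating (S : Triple f) : Prop :=
  ∀ x : KPoint f, Function.Surjective (S.fibreDifferential x)

/-- The family `(Eᵢ, pᵢ, sᵢ)` is dominating: `T_x X = ∑ᵢ dsᵢ (T_{0_{i,x}} E_{i,x})` for every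
`x ∈ X`. -/
def IsDominatingFamily {ι : Type*} (S : ι → Triple f) : Prop :=
  ∀ x : KPoint f, ⨆ i, LinearMap.range ((S i).fibreDifferential x) = ⊤

end Triple

end Spray

end AlgSpray

end

noncomputable section

namespace AlgSpray

/-! ### Normality of smooth algebras, and factorization over polynomial rings -/

section Algebra

open MvPolynomial

open scoped TensorProduct

/-! The projection `E₁ * E₂ → E₁` is the line bundle `s₁^* E₂` on the total space of the vector
bundle `E₁ → X`. The rank statement is therefore about bundles only (`nonempty_comp`): over a normal
integral `X`, a line bundle `P` on the total space of a rank `r` bundle `p : E → X` is a rank `r +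
1` bundle over `X`. Two facts give this.

(a) Every point of `X` has a neighbourhood `V` such that `P` is trivial on `p⁻¹(V)`
(`exists_isLinCoord`). The fibre coordinates of `E` together with a linear coordinate of `P` then
trivialize `P` over `V`. (b) Invertible functions on `p⁻¹(V)` come from `V` (`eq_pb_of_isUnit`). Two
linear coordinates of `P` thus differ by a unit on the base, and the transition matrices are block
diagonal with entries on `X`.

For (a), `p⁻¹(V)` is an affine space over a normal domain `A`. Over the fraction field of `A` the
polynomial ring is factorial, so a gcd trivializes the bundle. To descend to `A`, shrink `V` until
one trivializing open set of `P` contains the zero section over `V`, and normalize there to constant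
term one. Since `A` is normal, factors with constant term one of a polynomial over `A` have
coefficients in `A` (`mem_range_map_of_mul_eq_of_constantCoeff_one`); the other entries follow by
dividing power series. Normality holds because a smooth algebra is locally étale over a polynomial
ring.

The statement for several line bundles is an induction. For domination, the maps `e₁ ↦ (e₁, 0)` and
`e₂ ↦ (0, e₂)` embed both factors in the composition compatibly with `p`, `s` and the zero sections,
so by the chain rule the image of the differential of the composition contains those of all factors.
-/

theorem isIntegrallyClosed_of_isStandardEtale {P L : Type*} [CommRing P] [IsDomain P]
    [IsIntegrallyClosed P] [CommRing L] [IsDomain L] [Algebra P L] [Algebra.IsStandardEtale P L] :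
    IsIntegrallyClosed L := by
  let K := FractionRing P
  let T := TensorProduct P L K
  have hinj : Function.Injective (algebraMap P L) := FaithfulSMul.algebraMap_injective P L
  have hM : Algebra.algebraMapSubmonoid L (nonZeroDivisors P) ≤ nonZeroDivisors L := by
    rintro _ ⟨a, ha, rfl⟩
    rw [SetLike.mem_coe, mem_nonZeroDivisors_iff_ne_zero] at ha
    rw [mem_nonZeroDivisors_iff_ne_zero]
    exact (map_ne_zero_iff _ hinj).mpr ha
  have hloc : IsLocalization (Algebra.algebraMapSubmonoid L (nonZeroDivisors P)) T :=
    inferInstance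
  have hdom : IsDomain T := IsLocalization.isDomain_of_le_nonZeroDivisors T hM
  -- `T` is étale over the field `K`, hence finite; a domain integral over a field is a field, so
  -- `T` is the fraction field of `L`.
  have hfield : IsField T := by
    let e := Algebra.TensorProduct.comm P L K
    have : IsDomain (TensorProduct P K L) := e.symm.toMulEquiv.isDomain
    have : Module.Finite K (TensorProduct P K L) :=
      Algebra.FormallyUnramified.finite_of_free K (TensorProduct P K L)
    exact e.toMulEquiv.isField
      (isField_of_isIntegral_of_isField' (R := K) (Field.toIsField K))
  let := hfield.toField
  have : FaithfulSMul L T :=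
    (faithfulSMul_iff_algebraMap_injective L T).mpr (IsLocalization.injective _ hM)
  have : IsFractionRing L T := by
    refine IsFractionRing.of_field _ _ fun z => ?_
    obtain ⟨⟨x, y⟩, h⟩ := IsLocalization.surj (Algebra.algebraMapSubmonoid L (nonZeroDivisors P)) z
    refine ⟨x, y, ?_⟩
    have hy : algebraMap L T y ≠ 0 :=
      (IsLocalization.map_units T y).ne_zero
    exact (eq_div_iff hy).mpr h
  refine (isIntegrallyClosed_iff T).mpr fun {x} hx => ?_
  -- Integral closure commutes with smooth base change: what is integral over `L` in `T` comes from
  -- `L ⊗` the integral closure of `P` in `K`, and the latter is `P`.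
  obtain ⟨y, hy⟩ := (TensorProduct.toIntegralClosure_bijective_of_smooth
    (R := P) (S := L) (B := K)).2 ⟨x, hx⟩
  obtain rfl : TensorProduct.toIntegralClosure P L K y = x := congrArg Subtype.val hy
  clear hy hx
  induction y with
  | zero => exact ⟨0, by simp⟩
  | add a b ha hb =>
    obtain ⟨u, hu⟩ := ha
    obtain ⟨v, hv⟩ := hb
    exact ⟨u + v, by rw [map_add, hu, hv, map_add]; rfl⟩
  | tmul a b =>
    obtain ⟨c, hc⟩ := IsIntegrallyClosed.isIntegral_iff.mp b.2
    refine ⟨algebraMap P L c * a, ?_⟩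
    change (algebraMap P L c * a) ⊗ₜ[P] (1 : K) = a ⊗ₜ[P] b.1
    rw [← hc, ← Algebra.smul_def, TensorProduct.smul_tmul, Algebra.smul_def, mul_one]

/-- A domain which is smooth over a field is integrally closed. -/
theorem isIntegrallyClosed_of_smooth (k S : Type*) [Field k] [CommRing S] [IsDomain S]
    [Algebra k S] [Algebra.Smooth k S] : IsIntegrallyClosed S := by
  refine IsIntegrallyClosed.of_localization_maximal fun p _ _ => ?_
  -- Near each prime a smooth algebra is étale over a polynomial ring, which is factorial and hence
  -- normal.
  obtain ⟨f, hf, n, _, _, _⟩ :=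
    Algebra.IsSmoothAt.exists_isStandardEtale_mvPolynomial (R := k) (S := S) (p := p)
  have hf0 : f ≠ 0 := fun h => hf (h ▸ p.zero_mem)
  have : IsDomain (Localization.Away f) :=
    IsLocalization.isDomain_localization (powers_le_nonZeroDivisors_of_noZeroDivisors hf0)
  have : IsIntegrallyClosed (MvPolynomial (Fin n) k) :=
    UniqueFactorizationMonoid.instIsIntegrallyClosed
  have : IsIntegrallyClosed (Localization.Away f) :=
    isIntegrallyClosed_of_isStandardEtale (P := MvPolynomial (Fin n) k)
  have hle : Submonoid.powers f ≤ p.primeCompl := Submonoid.powers_le.mpr hf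
  let := IsLocalization.localizationAlgebraOfSubmonoidLe (Localization.Away f)
    (Localization.AtPrime p) (Submonoid.powers f) p.primeCompl hle
  have := IsLocalization.localization_isScalarTower_of_submonoid_le (Localization.Away f)
    (Localization.AtPrime p) (Submonoid.powers f) p.primeCompl hle
  have := IsLocalization.isLocalization_of_submonoid_le (Localization.Away f)
    (Localization.AtPrime p) (Submonoid.powers f) p.primeCompl hle
  refine _root_.isIntegrallyClosed_of_isLocalization (R := Localization.Away f) _
    (p.primeCompl.map (algebraMap S (Localization.Away f))) ?_
  rintro _ ⟨s, hs, rfl⟩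
  rw [mem_nonZeroDivisors_iff_ne_zero]
  intro h
  rw [map_eq_zero_iff _ (IsLocalization.injective _
    (powers_le_nonZeroDivisors_of_noZeroDivisors hf0))] at h
  exact hs (h ▸ p.zero_mem)

/-- In a unique factorization domain, rank one matrices which are idempotent up to a unit of
fractions are products of integral vectors. -/
theorem exists_common_factor {R F κ : Type*} [CommRing R] [IsDomain R]
    [UniqueFactorizationMonoid R] [Field F] [Algebra R F] [IsFractionRing R F] [Fintype κ]
    [Nonempty κ] (m n : κ → F) (hm : ∃ k, m k ≠ 0)
    (hmn : ∀ k l, m k * n l ∈ (algebraMap R F).range) :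
    ∃ d : F, d ≠ 0 ∧ ∃ f g : κ → R, (∀ k, m k = d * algebraMap R F (f k)) ∧
      ∀ k, n k = d⁻¹ * algebraMap R F (g k) := by
  classical
  obtain ⟨b, hb⟩ := IsLocalization.exist_integer_multiples_of_finite (nonZeroDivisors R) m
  choose p hp using hb
  let := UniqueFactorizationMonoid.toGCDMonoid R
  let : NormalizedGCDMonoid R := Classical.choice inferInstance
  obtain ⟨f, hf, hf1⟩ := Finset.extract_gcd (s := Finset.univ) p Finset.univ_nonempty
  set e := Finset.univ.gcd p
  have hb0 : algebraMap R F b ≠ 0 := IsFractionRing.to_map_ne_zero_of_mem_nonZeroDivisors b.2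
  have he : e ≠ 0 := by
    intro h
    obtain ⟨k, hk⟩ := hm
    apply hk
    have := hp k
    rw [hf k (Finset.mem_univ _), h, zero_mul, map_zero, Algebra.smul_def] at this
    exact (mul_eq_zero.mp this.symm).resolve_left hb0
  have he0 : algebraMap R F e ≠ 0 := by
    simpa using he
  have hmf : ∀ k, m k = algebraMap R F e / algebraMap R F b * algebraMap R F (f k) := by
    intro k
    have := hp k
    rw [hf k (Finset.mem_univ _), map_mul, Algebra.smul_def] at this
    field_simp
    rw [this]; ring
  set d := algebraMap R F e / algebraMap R F b with hd
  have hd0 : d ≠ 0 := div_ne_zero he0 hb0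
  -- The entries of `f` have gcd one. If `d * n l = u / v`, then `v` divides every `u * f k`, hence
  -- their gcd, which is `u` up to a unit.
  have key : ∀ l, ∃ g : R, algebraMap R F g = d * n l := by
    intro l
    obtain ⟨⟨u, v⟩, huv⟩ := IsLocalization.surj (nonZeroDivisors R) (d * n l)
    have hdvd : ∀ k, (v : R) ∣ u * f k := by
      intro k
      obtain ⟨c, hc⟩ := hmn k l
      refine ⟨c, IsFractionRing.injective R F ?_⟩
      rw [map_mul, map_mul, hc, ← huv, hmf]
      ring
    have h1 : (v : R) ∣ Finset.univ.gcd fun k => u * f k :=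
      Finset.dvd_gcd fun k _ => hdvd k
    have h2 := (Finset.gcd_mul_left' (s := Finset.univ) (f := f) u)
    rw [hf1, mul_one] at h2
    obtain ⟨g, rfl⟩ := h1.trans h2.dvd
    refine ⟨g, ?_⟩
    have hv : algebraMap R F v ≠ 0 := IsFractionRing.to_map_ne_zero_of_mem_nonZeroDivisors v.2
    apply mul_right_cancel₀ hv
    rw [huv, map_mul, mul_comm]
  choose g hg using key
  exact ⟨d, hd0, f, g, hmf, fun k => by rw [hg, inv_mul_cancel_left₀ hd0]⟩

/-! ### Coefficients of polynomial factors over a normal domain -/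

section Kronecker

variable {A K σ : Type*} [CommRing A] [IsIntegrallyClosed A] [Field K] [Algebra A K]
  [IsFractionRing A K]

/-- The substitution `f ↦ f(T X)`. -/
def homogenize (σ K : Type*) [CommRing K] :
    MvPolynomial σ K →+* Polynomial (MvPolynomial σ K) :=
  eval₂Hom (Polynomial.C.comp C) fun i => Polynomial.C (X i) * Polynomial.X

theorem eval_one_homogenize {K : Type*} [CommRing K] (f : MvPolynomial σ K) :
    (homogenize σ K f).eval 1 = f := by
  have : (Polynomial.evalRingHom (1 : MvPolynomial σ K)).comp (homogenize σ K) = .id _ := by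
    ext <;> simp [homogenize]
  exact congr($this f)

theorem coeff_zero_homogenize {K : Type*} [CommRing K] (f : MvPolynomial σ K) :
    (homogenize σ K f).coeff 0 = C (constantCoeff f) := by
  have : (Polynomial.constantCoeff).comp (homogenize σ K) = C.comp constantCoeff := by
    ext <;> simp [homogenize]
  exact congr($this f)

theorem map_homogenize {A K : Type*} [CommRing A] [CommRing K] (φ : A →+* K)
    (f : MvPolynomial σ A) :
    (homogenize σ A f).map (map φ) = homogenize σ K (map φ f) := by
  have : (Polynomial.mapRingHom (map φ)).comp (homogenize σ A) =
    (homogenize σ K).comp (map φ) := by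
    ext <;> simp [homogenize]
  exact congr($this f)

theorem monic_reverse_of_coeff_zero {R : Type*} [CommRing R] (p : Polynomial R)
    (h : p.coeff 0 = 1) :
    p.reverse.Monic := by
  nontriviality R
  rw [Polynomial.Monic, Polynomial.reverse_leadingCoeff, Polynomial.trailingCoeff,
    Polynomial.natTrailingDegree_eq_zero.mpr (Or.inr (by simp [h])), h]

-- Kronecker's argument. As a polynomial in `T`, `f(TX)` has constant term one, so its reverse is
-- monic and divides a monic polynomial over `A[X]`. Coefficients of such a factor are integral over
-- `A[X]`; setting `T = 1`, so is `f`, and normality of `A` applies to its coefficients.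
attribute [local instance] MvPolynomial.algebraMvPolynomial in
theorem mem_range_map_of_mul_eq_of_constantCoeff_one (f g : MvPolynomial σ K) (c : MvPolynomial σ A)
    (h : f * g = map (algebraMap A K) c) (hf : constantCoeff f = 1) (hg : constantCoeff g = 1) :
    f ∈ (map (algebraMap A K)).range := by
  have hc : constantCoeff c = 1 := by
    apply IsFractionRing.injective A K
    rw [← constantCoeff_map, ← h, map_mul, hf, hg, map_one, mul_one]
  have hrev : (homogenize σ K f).reverse ∣
      ((homogenize σ A c).reverse).map (algebraMap (MvPolynomial σ A) (MvPolynomial σ K)) := by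
    have : ((homogenize σ A c).reverse).map (algebraMap (MvPolynomial σ A) (MvPolynomial σ K)) =
        (homogenize σ K (map (algebraMap A K) c)).reverse := by
      rw [← map_homogenize, Polynomial.reverse, Polynomial.reverse, ← Polynomial.reflect_map,
        Polynomial.natDegree_map_eq_of_injective]
      · rfl
      · exact map_injective _ (IsFractionRing.injective A K)
    rw [this, ← h, map_mul, Polynomial.reverse_mul_of_domain]
    exact dvd_mul_right _ _
  have hint := Polynomial.isIntegral_coeff_of_dvd _ _
    (monic_reverse_of_coeff_zero _ (by rw [coeff_zero_homogenize, hc, map_one]))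
    (monic_reverse_of_coeff_zero _ (by rw [coeff_zero_homogenize, hf, map_one])) hrev
  have hint' : IsIntegral (MvPolynomial σ A) f := by
    rw [← eval_one_homogenize f, Polynomial.eval_eq_sum_range]
    refine IsIntegral.sum _ fun i _ => ?_
    rw [one_pow, mul_one, ← Polynomial.revAt_invol (N := (homogenize σ K f).natDegree) (i := i),
      ← Polynomial.coeff_reverse]
    exact hint _
  rw [MvPolynomial.isIntegral_iff_isIntegral_coeff] at hint'
  refine mem_range_map_iff_coeffs_subset.mpr ?_
  intro x hx
  obtain ⟨n, -, rfl⟩ := mem_coeffs_iff.mp hx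
  exact IsIntegrallyClosed.isIntegral_iff.mp (hint' n)

/-- `g` is invertible as a power series over `A`, so the coefficients of `f = c g⁻¹` come from `A`.
-/
theorem mem_range_map_of_mul_eq {A K : Type*} [CommRing A] [CommRing K] [Algebra A K]
    (f : MvPolynomial σ K) (g c : MvPolynomial σ A)
    (h : f * map (algebraMap A K) g = map (algebraMap A K) c) (hg : IsUnit (constantCoeff g)) :
    f ∈ (map (algebraMap A K)).range := by
  obtain ⟨u, hu⟩ := hg
  have h1 : (f : MvPowerSeries σ K) = MvPowerSeries.map (algebraMap A K)
      ((c : MvPowerSeries σ A) * MvPowerSeries.invOfUnit (g : MvPowerSeries σ A) u) := by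
    have h2 : (g : MvPowerSeries σ A) * MvPowerSeries.invOfUnit (g : MvPowerSeries σ A) u = 1 :=
      MvPowerSeries.mul_invOfUnit _ _ (by
        rw [hu, ← MvPowerSeries.coeff_zero_eq_constantCoeff_apply, MvPolynomial.coeff_coe]; rfl)
    have h3 : (f : MvPowerSeries σ K) * MvPowerSeries.map (algebraMap A K) (g : MvPowerSeries σ A) =
        MvPowerSeries.map (algebraMap A K) (c : MvPowerSeries σ A) := by
      have := congrArg (fun p : MvPolynomial σ K => (p : MvPowerSeries σ K)) h
      rw [MvPolynomial.coe_mul] at this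
      have h4 : ∀ p : MvPolynomial σ A, MvPowerSeries.map (algebraMap A K) (p : MvPowerSeries σ A) =
          (map (algebraMap A K) p : MvPolynomial σ K) := fun p => by
        ext n
        rw [MvPowerSeries.coeff_map, coeff_coe, coeff_coe, coeff_map]
      rw [h4, h4, this]
    rw [map_mul, ← h3, mul_assoc, ← map_mul, h2, map_one, mul_one]
  refine mem_range_map_iff_coeffs_subset.mpr ?_
  intro x hx
  obtain ⟨n, -, rfl⟩ := mem_coeffs_iff.mp hx
  rw [← MvPolynomial.coeff_coe, h1, MvPowerSeries.coeff_map]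
  exact ⟨_, rfl⟩

end Kronecker

attribute [local instance] MvPolynomial.algebraMvPolynomial in
/-- Line bundles on affine space over a normal domain which are trivial at the origin are trivial,
in terms of fractional ideals. -/
theorem exists_factor_mvPolynomial {A σ F κ : Type*} [CommRing A] [IsDomain A]
    [IsIntegrallyClosed A] [Field F] [Algebra (MvPolynomial σ A) F]
    [IsFractionRing (MvPolynomial σ A) F] [Fintype κ] (m n : κ → F)
    (hmn : ∀ k l, m k * n l ∈ (algebraMap (MvPolynomial σ A) F).range) (k₀ : κ)
    (c : MvPolynomial σ A) (hc : m k₀ * n k₀ = algebraMap _ F c) (hu : IsUnit (constantCoeff c)) :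
    ∃ d : F, d ≠ 0 ∧ ∃ f g : κ → MvPolynomial σ A, (∀ k, m k = d * algebraMap _ F (f k)) ∧
      ∀ k, n k = d⁻¹ * algebraMap _ F (g k) := by
  let K := FractionRing A
  let M : Submonoid (MvPolynomial σ A) := (nonZeroDivisors A).map (C (σ := σ))
  have hM : M ≤ nonZeroDivisors (MvPolynomial σ A) := by
    rintro _ ⟨a, ha, rfl⟩
    simpa using ha
  have : IsLocalization M (MvPolynomial σ K) := MvPolynomial.isLocalization ..
  let j : MvPolynomial σ K →+* F := IsLocalization.lift (M := M) (g := algebraMap _ F) fun y =>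
    (IsFractionRing.to_map_ne_zero_of_mem_nonZeroDivisors (hM y.2)).isUnit
  let : Algebra (MvPolynomial σ K) F := j.toAlgebra
  have hj : ∀ p : MvPolynomial σ A, algebraMap (MvPolynomial σ K) F (map (algebraMap A K) p) =
    algebraMap _ F p := fun p =>
    IsLocalization.lift_eq (M := M) (S := MvPolynomial σ K) _ p
  have : IsScalarTower (MvPolynomial σ A) (MvPolynomial σ K) F :=
    .of_algebraMap_eq fun p => (hj p).symm
  have : IsFractionRing (MvPolynomial σ K) F :=
    IsFractionRing.isFractionRing_of_isDomain_of_isLocalization M _ _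
  have hinj := IsFractionRing.injective (MvPolynomial σ K) F
  have : Nonempty κ := ⟨k₀⟩
  have hc0 : constantCoeff c ≠ 0 := hu.ne_zero
  -- The factorization exists over the field `K`; what remains is to rescale it by the constant `a`
  -- so that all coefficients lie in `A`.
  obtain ⟨d, hd, f, g, hf, hg⟩ := exists_common_factor (R := MvPolynomial σ K) m n
    ⟨k₀, fun h => hc0 <| by
      rw [h, zero_mul] at hc
      rw [(map_eq_zero_iff _ (IsFractionRing.injective _ F)).mp hc.symm, map_zero]⟩
    (fun k l => by obtain ⟨p, hp⟩ := hmn k l; exact ⟨map (algebraMap A K) p, by rw [hj, hp]⟩)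
  have hfg : ∀ k l, ∃ p : MvPolynomial σ A, f k * g l = map (algebraMap A K) p := by
    intro k l
    obtain ⟨p, hp⟩ := hmn k l
    refine ⟨p, hinj ?_⟩
    rw [hj, hp, map_mul, hf, hg]
    field_simp
  have hfg0 : f k₀ * g k₀ = map (algebraMap A K) c := by
    apply hinj
    rw [hj, ← hc, map_mul, hf, hg]
    field_simp
  have hcc : constantCoeff (f k₀) * constantCoeff (g k₀) = algebraMap A K (constantCoeff c) := by
    rw [← map_mul, hfg0, constantCoeff_map]
  have hcc0 : algebraMap A K (constantCoeff c) ≠ 0 := by simpa using hc0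
  set a := constantCoeff (f k₀)
  have ha : a ≠ 0 := left_ne_zero_of_mul (hcc.trans_ne hcc0)
  set b := constantCoeff (g k₀)
  have hb : b ≠ 0 := right_ne_zero_of_mul (hcc.trans_ne hcc0)
  obtain ⟨u, hu⟩ := hu
  -- the vectors normalized at the origin
  have h1 : C a⁻¹ * f k₀ ∈ (map (σ := σ) (algebraMap A K)).range := by
    refine mem_range_map_of_mul_eq_of_constantCoeff_one _ (C b⁻¹ * g k₀) (C (↑u⁻¹ : A) * c) ?_
      ?_ ?_
    · rw [map_mul, map_C, ← hfg0, mul_mul_mul_comm, ← C_mul]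
      congr 2
      rw [← mul_inv, hcc, ← hu]
      simp
    · rw [map_mul, constantCoeff_C]; exact inv_mul_cancel₀ ha
    · rw [map_mul, constantCoeff_C]; exact inv_mul_cancel₀ hb
  have h2 : C b⁻¹ * g k₀ ∈ (map (σ := σ) (algebraMap A K)).range := by
    refine mem_range_map_of_mul_eq_of_constantCoeff_one _ (C a⁻¹ * f k₀) (C (↑u⁻¹ : A) * c) ?_
      ?_ ?_
    · rw [map_mul, map_C, ← hfg0, mul_mul_mul_comm, ← C_mul, mul_comm (g k₀)]
      congr 2
      rw [mul_comm, ← mul_inv, hcc, ← hu]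
      simp
    · rw [map_mul, constantCoeff_C]; exact inv_mul_cancel₀ hb
    · rw [map_mul, constantCoeff_C]; exact inv_mul_cancel₀ ha
  obtain ⟨f₀, hf₀⟩ := h1
  obtain ⟨g₀, hg₀⟩ := h2
  have hba : C a * C b = map (σ := σ) (algebraMap A K) (C (u : A)) := by
    rw [← C_mul, hcc, map_C, hu]
  have hab : C a * C (σ := σ) a⁻¹ = 1 := by rw [← C_mul, mul_inv_cancel₀ ha, C_1]
  have hbb : C b * C (σ := σ) b⁻¹ = 1 := by rw [← C_mul, mul_inv_cancel₀ hb, C_1]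
  -- The product with `g₀` is defined over `A`, and `g₀` has constant term one, so it can be divided
  -- out.
  have hF : ∀ k, C a⁻¹ * f k ∈ (map (σ := σ) (algebraMap A K)).range := by
    intro k
    obtain ⟨p, hp⟩ := hfg k k₀
    refine mem_range_map_of_mul_eq _ g₀ (C (↑u⁻¹ : A) * p) ?_ ?_
    · rw [hg₀, map_mul, ← hp, mul_mul_mul_comm, ← C_mul, map_C]
      congr 2
      rw [← mul_inv, hcc, ← hu]
      simp
    · have : constantCoeff g₀ = 1 := by
        apply IsFractionRing.injective A K
        rw [← constantCoeff_map, hg₀, map_mul, constantCoeff_C, map_one]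
        exact inv_mul_cancel₀ hb
      rw [this]; exact isUnit_one
  have hG : ∀ k, C a * g k ∈ (map (σ := σ) (algebraMap A K)).range := by
    intro k
    obtain ⟨p, hp⟩ := hfg k₀ k
    refine mem_range_map_of_mul_eq _ f₀ p ?_ ?_
    · rw [hf₀, ← hp]
      linear_combination (f k₀ * g k) * hab
    · have : constantCoeff f₀ = 1 := by
        apply IsFractionRing.injective A K
        rw [← constantCoeff_map, hf₀, map_mul, constantCoeff_C, map_one]
        exact inv_mul_cancel₀ ha
      rw [this]; exact isUnit_one
  choose F' hF' using hF
  choose G' hG' using hG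
  set α := algebraMap (MvPolynomial σ K) F (C a)
  have hα : α ≠ 0 := by simpa [α] using ha
  refine ⟨d * α, mul_ne_zero hd hα, F', G', fun k => ?_, fun k => ?_⟩
  · rw [hf, ← hj, hF', mul_assoc]
    congr 1
    rw [← map_mul, ← mul_assoc, hab, one_mul]
  · rw [hg, ← hj, hG', map_mul, mul_inv, mul_assoc, inv_mul_cancel_left₀ hα]

end Algebra

/-! ### Pulling back and restricting functions -/

section Functions

variable {S T Y Z : Scheme.{u}}

/-- Pullback of functions along a morphism. -/
def pb (b : T ⟶ Y) {V : T.Opens} {W : Y.Opens} (e : V ≤ b ⁻¹ᵁ W) : Γ(Y, W) →+* Γ(T, V) :=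
  (b.appLE W V e).hom

/-- Restriction of functions. -/
def res {W' W : Y.Opens} (h : W' ≤ W) : Γ(Y, W) →+* Γ(Y, W') := (Y.presheaf.map (homOfLE h).op).hom

theorem pb_pb (a : S ⟶ T) (b : T ⟶ Y) {U : S.Opens} {V : T.Opens} {W : Y.Opens} (e : V ≤ b ⁻¹ᵁ W)
    (e' : U ≤ a ⁻¹ᵁ V) (f : Γ(Y, W)) :
    pb a e' (pb b e f) = pb (a ≫ b) (e'.trans (a.preimage_mono e)) f :=
  congr($(Scheme.Hom.appLE_comp_appLE a b W V U e e').hom f)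

theorem res_pb (b : T ⟶ Y) {V V' : T.Opens} {W : Y.Opens} (e : V ≤ b ⁻¹ᵁ W) (h : V' ≤ V)
    (f : Γ(Y, W)) : res h (pb b e f) = pb b (h.trans e) f :=
  congr($(Scheme.Hom.appLE_map b e (homOfLE h).op).hom f)

theorem pb_res (b : T ⟶ Y) {V : T.Opens} {W W' : Y.Opens} (e : V ≤ b ⁻¹ᵁ W') (h : W' ≤ W)
    (f : Γ(Y, W)) : pb b e (res h f) = pb b (e.trans (b.preimage_mono h)) f :=
  congr($(Scheme.Hom.map_appLE b e (homOfLE h).op).hom f)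

theorem res_res {W W' W'' : Y.Opens} (h : W' ≤ W) (h' : W'' ≤ W') (f : Γ(Y, W)) :
    res h' (res h f) = res (h'.trans h) f := by
  have : Y.presheaf.map (homOfLE h).op ≫ Y.presheaf.map (homOfLE h').op =
      Y.presheaf.map (homOfLE (h'.trans h)).op := by rw [← Functor.map_comp]; rfl
  exact congr($(this).hom f)

theorem res_self {W : Y.Opens} (h : W ≤ W) (f : Γ(Y, W)) : res h f = f := by
  have : Y.presheaf.map (homOfLE h).op = 𝟙 _ := Y.presheaf.map_id _
  exact congr($(this).hom f)

theorem app_eq_pb (b : T ⟶ Y) {W : Y.Opens} (f : Γ(Y, W)) : b.app W f = pb b le_rfl f :=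
  congr($(Scheme.Hom.app_eq_appLE b (U := W)).hom f)

theorem pb_congr {b b' : T ⟶ Y} (h : b = b') {V : T.Opens} {W : Y.Opens} (e : V ≤ b ⁻¹ᵁ W)
    (f : Γ(Y, W)) : pb b e f = pb b' (h ▸ e) f := by subst h; rfl

theorem pb_id {V W : Y.Opens} (e : V ≤ W) (f : Γ(Y, W)) : pb (𝟙 Y) e f = res e f :=
  have : (𝟙 Y : Y ⟶ Y).appLE W V e = Y.presheaf.map (homOfLE e).op := by
    simp only [Scheme.Hom.appLE, Scheme.Hom.id_app]
    exact Category.id_comp _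
  congr($(this).hom f)

theorem comp_appTop_apply (a : S ⟶ T) (b : T ⟶ Y) (f : Γ(Y, ⊤)) :
    (a ≫ b).appTop f = a.appTop (b.appTop f) := by
  rw [Scheme.Hom.comp_appTop, CommRingCat.comp_apply]

theorem top_le_ι_preimage (W : Y.Opens) : (⊤ : W.toScheme.Opens) ≤ W.ι ⁻¹ᵁ W :=
  W.ι_preimage_self.ge

theorem pb_ι_eq_topIso_inv (W : Y.Opens) (f : Γ(Y, W)) :
    pb W.ι (top_le_ι_preimage W) f = W.topIso.inv f := by
  have : W.ι.appLE W ⊤ (top_le_ι_preimage W) = W.topIso.inv := by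
    rw [Scheme.Opens.ι_appLE]; rfl
  exact congr($(this).hom f)

theorem pb_ι_injective (W : Y.Opens) : Function.Injective (pb W.ι (top_le_ι_preimage W)) := by
  intro f g h
  rw [pb_ι_eq_topIso_inv, pb_ι_eq_topIso_inv] at h
  exact (ConcreteCategory.bijective_of_isIso W.topIso.inv).1 h

theorem fun_ext_of_locally {W : Y.Opens} (f g : Γ(Y, W))
    (H : ∀ y ∈ W, ∃ (N : Y.Opens) (h : N ≤ W), y ∈ N ∧ res h f = res h g) : f = g := by
  choose N hN hyN hfg using H
  refine Y.sheaf.eq_of_locally_eq' (fun y : W => N y.1 y.2) W (fun y => homOfLE (hN y.1 y.2)) ?_ f g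
    fun y => hfg y.1 y.2
  intro y hy
  exact TopologicalSpace.Opens.mem_iSup.mpr ⟨⟨y, hy⟩, hyN y hy⟩

theorem isUnit_of_locally {W : Y.Opens} (f : Γ(Y, W))
    (H : ∀ y ∈ W, ∃ (N : Y.Opens) (h : N ≤ W), y ∈ N ∧ IsUnit (res h f)) : IsUnit f := by
  have : Y.basicOpen f = W := by
    refine le_antisymm (Y.basicOpen_le f) fun y hy => ?_
    obtain ⟨N, h, hyN, hu⟩ := H y hy
    rw [Scheme.mem_basicOpen _ _ _ hy]
    have := hu.map (Y.presheaf.germ N y hyN).hom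
    rwa [show (Y.presheaf.germ N y hyN).hom (res h f) = Y.presheaf.germ W y hy f from
      Y.presheaf.germ_res_apply (homOfLE h) y hyN f] at this
  have h2 := Y.toRingedSpace.isUnit_res_basicOpen f
  have h3 : IsUnit (res this.ge (res (Y.basicOpen_le f) f)) := h2.map _
  rwa [res_res, res_self] at h3

end Functions

/-! ### Fibre coordinates -/

section Chart

variable {E P X Y : Scheme.{u}}

/-- The functions `t` on `p⁻¹(U)` identify `p⁻¹(U)` with the product of `U` and an affine space, in
terms of the functor of points. -/
structure IsChart (p : E ⟶ X) (U : X.Opens) {n : Type*} (t : n → Γ(E, p ⁻¹ᵁ U)) : Prop where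
  exists_lift : ∀ {T : Scheme.{u}} (a : T ⟶ X) (_ : ⊤ ≤ a ⁻¹ᵁ U) (c : n → Γ(T, ⊤)),
    ∃ (b : T ⟶ E) (e : ⊤ ≤ b ⁻¹ᵁ p ⁻¹ᵁ U), b ≫ p = a ∧ ∀ k, pb b e (t k) = c k
  hom_ext : ∀ {T : Scheme.{u}} (b b' : T ⟶ E) (e : ⊤ ≤ b ⁻¹ᵁ p ⁻¹ᵁ U) (e' : ⊤ ≤ b' ⁻¹ᵁ p ⁻¹ᵁ U),
    b ≫ p = b' ≫ p → (∀ k, pb b e (t k) = pb b' e' (t k)) → b = b'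

theorem exists_lift_ι {T : Scheme.{u}} (a : T ⟶ X) (U : X.Opens) (h : ⊤ ≤ a ⁻¹ᵁ U) :
    ∃ a' : T ⟶ U, a' ≫ U.ι = a := by
  refine ⟨IsOpenImmersion.lift U.ι a ?_, IsOpenImmersion.lift_fac _ _ _⟩
  rw [Scheme.Opens.range_ι]
  rintro _ ⟨x, rfl⟩
  exact h (TopologicalSpace.Opens.mem_top x)

theorem appTop_topIso_inv {T : Scheme.{u}} {U : X.Opens} (a : T ⟶ U) (e : ⊤ ≤ (a ≫ U.ι) ⁻¹ᵁ U)
    (f : Γ(X, U)) : a.appTop (U.topIso.inv f) = pb (a ≫ U.ι) e f := by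
  rw [← pb_ι_eq_topIso_inv]
  exact (app_eq_pb a _).trans (pb_pb a U.ι _ _ f)

/-- Yoneda. Once charts are expressed through the functor of points, base change, composition and
gluing of charts become formal. -/
theorem isIso_homOfVector_iff (p : E ⟶ X) (U : X.Opens) {n : Type u} (t : n → Γ(E, p ⁻¹ᵁ U)) :
    IsIso (AffineSpace.homOfVector (p ∣_ U) fun k => (p ⁻¹ᵁ U).topIso.inv (t k)) ↔
      IsChart p U t := by
  set φ := AffineSpace.homOfVector (p ∣_ U) fun k => (p ⁻¹ᵁ U).topIso.inv (t k) with hφ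
  have hover : φ ≫ (AffineSpace n U ↘ U.toScheme) = p ∣_ U := AffineSpace.homOfVector_over _ _
  have hcoord : ∀ k, φ.appTop (AffineSpace.coord _ k) = (p ⁻¹ᵁ U).topIso.inv (t k) :=
    AffineSpace.homOfVector_appTop_coord _ _
  constructor
  · intro h
    constructor
    · intro T a ha c
      obtain ⟨a', rfl⟩ := exists_lift_ι a U ha
      let b' := AffineSpace.homOfVector a' c ≫ inv φ
      have hb' : b' ≫ p ∣_ U = a' := by
        rw [← hover]
        simp [b']
      have e : ⊤ ≤ (b' ≫ (p ⁻¹ᵁ U).ι) ⁻¹ᵁ p ⁻¹ᵁ U := by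
        intro x _
        exact (b' x).2
      refine ⟨b' ≫ (p ⁻¹ᵁ U).ι, e, ?_, ?_⟩
      · rw [Category.assoc, ← morphismRestrict_ι, reassoc_of% hb']
      · intro k
        rw [← appTop_topIso_inv, ← hcoord, ← comp_appTop_apply]
        simp only [b', Category.assoc, IsIso.inv_hom_id, Category.comp_id]
        exact AffineSpace.homOfVector_appTop_coord _ _ _
    · intro T b b' e e' h1 h2
      obtain ⟨b, rfl⟩ := exists_lift_ι b _ e
      obtain ⟨b', rfl⟩ := exists_lift_ι b' _ e'
      congr 1
      rw [← cancel_mono φ]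
      apply AffineSpace.hom_ext
      · rw [Category.assoc, Category.assoc, hover, ← cancel_mono U.ι]
        simpa using h1
      · intro k
        rw [comp_appTop_apply, comp_appTop_apply, hcoord,
          appTop_topIso_inv _ e, appTop_topIso_inv _ e', h2]
  · intro h
    obtain ⟨b, e, hb, hbt⟩ := h.exists_lift ((AffineSpace n U ↘ U.toScheme) ≫ U.ι)
      (fun x _ => ((AffineSpace n U ↘ U.toScheme) x).2) (AffineSpace.coord _)
    obtain ⟨b, rfl⟩ := exists_lift_ι b _ e
    have hbp : b ≫ p ∣_ U = AffineSpace n U ↘ U.toScheme := by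
      rw [← cancel_mono U.ι]
      simpa using hb
    have h1 : b ≫ φ = 𝟙 _ := by
      apply AffineSpace.hom_ext
      · rw [Category.assoc, hover, hbp, Category.id_comp]
      · intro k
        rw [comp_appTop_apply, hcoord, appTop_topIso_inv _ e, hbt]
        simp
    refine ⟨b, ?_, h1⟩
    rw [← cancel_mono (p ⁻¹ᵁ U).ι]
    have e1 : (⊤ : (p ⁻¹ᵁ U).toScheme.Opens) ≤ ((φ ≫ b) ≫ (p ⁻¹ᵁ U).ι) ⁻¹ᵁ p ⁻¹ᵁ U :=
      fun x _ => (b (φ x)).2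
    have e2 : (⊤ : (p ⁻¹ᵁ U).toScheme.Opens) ≤ (𝟙 _ ≫ (p ⁻¹ᵁ U).ι) ⁻¹ᵁ p ⁻¹ᵁ U :=
      fun x _ => x.2
    refine h.hom_ext _ _ e1 e2 ?_ ?_
    · rw [Category.assoc, Category.assoc, Category.id_comp, ← morphismRestrict_ι,
        reassoc_of% hbp, reassoc_of% hover]
    · intro k
      rw [← appTop_topIso_inv, ← appTop_topIso_inv, ← hcoord, ← comp_appTop_apply,
        ← comp_appTop_apply, Category.assoc, h1, Category.comp_id, Category.id_comp]

theorem IsChart.reindex {p : E ⟶ X} {U : X.Opens} {n m : Type*} {t : n → Γ(E, p ⁻¹ᵁ U)}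
    (h : IsChart p U t) (e : m ≃ n) : IsChart p U (t ∘ e) where
  exists_lift a ha c := by
    obtain ⟨b, hb, h1, h2⟩ := h.exists_lift a ha (c ∘ e.symm)
    exact ⟨b, hb, h1, fun k => by rw [Function.comp_apply, h2]; simp⟩
  hom_ext b b' hb hb' h1 h2 := h.hom_ext b b' hb hb' h1 fun k => by
    simpa using h2 (e.symm k)

theorem IsChart.restrict {p : E ⟶ X} {U U' : X.Opens} {n : Type*} {t : n → Γ(E, p ⁻¹ᵁ U)}
    (h : IsChart p U t) (hU : U' ≤ U) : IsChart p U' fun k => res (p.preimage_mono hU) (t k) where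
  exists_lift a ha c := by
    obtain ⟨b, hb, h1, h2⟩ := h.exists_lift a (ha.trans (a.preimage_mono hU)) c
    have hb' : ⊤ ≤ b ⁻¹ᵁ p ⁻¹ᵁ U' := by subst h1; exact ha
    exact ⟨b, hb', h1, fun k => by rw [pb_res, h2]⟩
  hom_ext b b' hb hb' h1 h2 := by
    simp only [pb_res] at h2
    exact h.hom_ext b b' _ _ h1 h2

theorem preimage_le_of_isPullback {p : E ⟶ X} {s : Y ⟶ X} {q : P ⟶ Y} {s' : P ⟶ E}
    (H : IsPullback s' q p s) (U : X.Opens) : q ⁻¹ᵁ s ⁻¹ᵁ U ≤ s' ⁻¹ᵁ p ⁻¹ᵁ U := by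
  change (q ≫ s) ⁻¹ᵁ U ≤ (s' ≫ p) ⁻¹ᵁ U
  rw [H.w]

theorem IsChart.baseChange {p : E ⟶ X} {s : Y ⟶ X} {q : P ⟶ Y} {s' : P ⟶ E}
    (H : IsPullback s' q p s) {U : X.Opens} {n : Type*} {t : n → Γ(E, p ⁻¹ᵁ U)}
    (h : IsChart p U t) :
    IsChart q (s ⁻¹ᵁ U) fun k => pb s' (preimage_le_of_isPullback H U) (t k) where
  exists_lift a ha c := by
    obtain ⟨b, hb, h1, h2⟩ := h.exists_lift (a ≫ s) ha c
    have h3 : H.lift b a h1 ≫ q = a := H.lift_snd _ _ _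
    have h4 : H.lift b a h1 ≫ s' = b := H.lift_fst _ _ _
    have e : ⊤ ≤ H.lift b a h1 ⁻¹ᵁ q ⁻¹ᵁ s ⁻¹ᵁ U := by
      change ⊤ ≤ (H.lift b a h1 ≫ q) ⁻¹ᵁ s ⁻¹ᵁ U
      rw [h3]; exact ha
    refine ⟨H.lift b a h1, e, h3, fun k => ?_⟩
    rw [pb_pb, pb_congr h4, h2]
  hom_ext b b' hb hb' h1 h2 := by
    simp only [pb_pb] at h2
    refine H.hom_ext (h.hom_ext _ _ _ _ ?_ h2) h1
    rw [Category.assoc, Category.assoc, H.w, reassoc_of% h1]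

theorem IsChart.comp {q : P ⟶ E} {p : E ⟶ X} {U : X.Opens} {n m : Type*}
    {t : n → Γ(E, p ⁻¹ᵁ U)} {w : m → Γ(P, q ⁻¹ᵁ p ⁻¹ᵁ U)} (hw : IsChart q (p ⁻¹ᵁ U) w)
    (ht : IsChart p U t) :
    IsChart (q ≫ p) U (Sum.elim (fun k => pb q le_rfl (t k)) w : n ⊕ m → Γ(P, (q ≫ p) ⁻¹ᵁ U)) where
  exists_lift a ha c := by
    obtain ⟨b, hb, rfl, h2⟩ := ht.exists_lift a ha (c ∘ Sum.inl)
    obtain ⟨d, hd, rfl, h3⟩ := hw.exists_lift b hb (c ∘ Sum.inr)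
    refine ⟨d, hd, (Category.assoc _ _ _).symm, ?_⟩
    rintro (k | k)
    · exact (pb_pb _ _ _ _ _).trans (h2 k)
    · exact h3 k
  hom_ext b b' hb hb' h1 h2 := by
    refine hw.hom_ext b b' hb hb' (ht.hom_ext _ _ hb hb' (by simpa using h1) fun k => ?_) fun k =>
      h2 (Sum.inr k)
    exact (pb_pb b q le_rfl hb (t k)).symm.trans
      ((h2 (Sum.inl k)).trans (pb_pb b' q le_rfl hb' (t k)))

theorem IsChart.unit_mul {q : P ⟶ E} {W : E.Opens} {n : Type*} {t : n → Γ(P, q ⁻¹ᵁ W)}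
    (ht : IsChart q W t) (c : Γ(E, W)) (hc : IsUnit c) :
    IsChart q W fun k => pb q le_rfl c * t k where
  exists_lift {T} a ha v := by
    obtain ⟨u, hu⟩ := hc.map (pb a ha)
    obtain ⟨b, hb, h1, h2⟩ := ht.exists_lift a ha fun k => ↑u⁻¹ * v k
    refine ⟨b, hb, h1, fun k => ?_⟩
    rw [map_mul, h2, pb_pb, pb_congr h1, ← hu, Units.mul_inv_cancel_left]
  hom_ext b b' hb hb' h1 h2 := by
    refine ht.hom_ext b b' hb hb' h1 fun k => ?_
    have := h2 k
    rw [map_mul, map_mul, pb_pb, pb_pb, pb_congr h1] at this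
    exact (hc.map (pb (b' ≫ q) (show ⊤ ≤ b' ⁻¹ᵁ q ⁻¹ᵁ W from hb'))).mul_left_cancel this

/-- Uniqueness of lifts is local, and it makes the local lifts agree on overlaps, so that they glue.
-/
theorem IsChart.of_locally {p : E ⟶ X} {U : X.Opens} {n : Type*} (t : n → Γ(E, p ⁻¹ᵁ U))
    (H : ∀ x ∈ U, ∃ (N : X.Opens) (h : N ≤ U), x ∈ N ∧
      IsChart p N fun k => res (p.preimage_mono h) (t k)) : IsChart p U t := by
  choose N hN hxN hc using H
  have hext : ∀ {T : Scheme.{u}} (b b' : T ⟶ E) (e : ⊤ ≤ b ⁻¹ᵁ p ⁻¹ᵁ U)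
      (e' : ⊤ ≤ b' ⁻¹ᵁ p ⁻¹ᵁ U), b ≫ p = b' ≫ p →
      (∀ k, pb b e (t k) = pb b' e' (t k)) → b = b' := by
    intro T b b' e e' h1 h2
    refine Scheme.hom_ext_of_forall _ _ fun x => ?_
    have hx : (b ≫ p) x ∈ U := e (TopologicalSpace.Opens.mem_top x)
    obtain ⟨M, hM, hxM, hcM⟩ : ∃ (M : X.Opens) (h : M ≤ U), (b ≫ p) x ∈ M ∧
        IsChart p M fun k => res (p.preimage_mono h) (t k) := ⟨_, hN _ hx, hxN _ hx, hc _ hx⟩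
    let O : T.Opens := (b ≫ p) ⁻¹ᵁ M
    refine ⟨O, hxM, ?_⟩
    have e1 : ⊤ ≤ (O.ι ≫ b) ⁻¹ᵁ p ⁻¹ᵁ M := fun y _ => y.2
    have e2 : ⊤ ≤ (O.ι ≫ b') ⁻¹ᵁ p ⁻¹ᵁ M := fun y _ => by
      have : y.1 ∈ (b ≫ p) ⁻¹ᵁ M := y.2
      rw [h1] at this
      exact this
    refine hcM.hom_ext _ _ e1 e2 (by simp [h1]) fun k => ?_
    rw [pb_res, pb_res]
    exact (pb_pb O.ι b e (V := ⊤) (U := ⊤) le_top (t k)).symm.trans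
      ((congrArg (pb O.ι (V := ⊤) le_top) (h2 k)).trans
      (pb_pb O.ι b' e' (V := ⊤) (U := ⊤) le_top (t k)))
  refine ⟨?_, hext⟩
  intro T a ha c
  have hx : ∀ x : T, a x ∈ U := fun x => ha (TopologicalSpace.Opens.mem_top x)
  let O : T → T.Opens := fun x => a ⁻¹ᵁ N _ (hx x)
  have hO : ∀ x, ⊤ ≤ ((O x).ι ≫ a) ⁻¹ᵁ N _ (hx x) := fun x y _ => y.2
  let 𝒰 : T.OpenCover :=
    { I₀ := T, X x := (O x), f x := (O x).ι,
      mem₀ := by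
        rw [Scheme.presieve₀_mem_precoverage_iff]
        exact ⟨fun x => ⟨x, by simpa using (show x ∈ O x from hxN _ (hx x))⟩, inferInstance⟩ }
  choose b e hb hbt using fun x => (hc _ (hx x)).exists_lift ((O x).ι ≫ a) (hO x)
    fun k => pb (O x).ι (V := ⊤) (W := ⊤) le_top (c k)
  have e' : ∀ x, ⊤ ≤ (b x) ⁻¹ᵁ p ⁻¹ᵁ U := fun x =>
    (e x).trans ((b x).preimage_mono (p.preimage_mono (hN _ (hx x))))
  have hbt' : ∀ x k, pb (b x) (e' x) (t k) = pb (O x).ι (V := ⊤) (W := ⊤) le_top (c k) := by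
    intro x k
    rw [← hbt, pb_res]
  let B : T ⟶ E := 𝒰.glueMorphisms b (by
    intro x y
    refine hext _ _ ?_ ?_ ?_ ?_
    · exact fun z _ => e' x (TopologicalSpace.Opens.mem_top _)
    · exact fun z _ => e' y (TopologicalSpace.Opens.mem_top _)
    · rw [Category.assoc, Category.assoc, hb, hb]
      exact pullback.condition_assoc _
    · intro k
      have h1 := congrArg (pb (pullback.fst (𝒰.f x) (𝒰.f y)) (V := ⊤) le_top) (hbt' x k)
      have h2 := congrArg (pb (pullback.snd (𝒰.f x) (𝒰.f y)) (V := ⊤) le_top) (hbt' y k)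
      have h3 := (pb_pb _ _ _ _ _).symm.trans (h1.trans (pb_pb _ _ _ _ _))
      have h4 := (pb_pb _ _ _ _ _).symm.trans (h2.trans (pb_pb _ _ _ _ _))
      exact h3.trans ((pb_congr pullback.condition _ _).trans h4.symm))
  have hB : ∀ x, (O x).ι ≫ B = b x := fun x => 𝒰.ι_glueMorphisms b _ x
  have hBp : B ≫ p = a := 𝒰.hom_ext _ _ fun x => by
    change (O x).ι ≫ B ≫ p = (O x).ι ≫ a
    rw [reassoc_of% hB, hb]
  have eB : ⊤ ≤ B ⁻¹ᵁ p ⁻¹ᵁ U := by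
    change ⊤ ≤ (B ≫ p) ⁻¹ᵁ U
    rw [hBp]; exact ha
  refine ⟨B, eB, hBp, fun k => fun_ext_of_locally _ _ fun x _ => ⟨O x, le_top, hxN _ (hx x), ?_⟩⟩
  apply pb_ι_injective
  rw [pb_res, pb_res, pb_pb, pb_congr (hB x), hbt']

end Chart

/-! ### Vector bundles through charts -/

namespace VectorBundleStructure

variable {E P X Y : Scheme.{u}} {r : ℕ}

theorem isChart {p : E ⟶ X} {z : X ⟶ E} (B : VectorBundleStructure p z r) (i : B.ι) :
    IsChart p (B.U i) (B.t i) :=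
  ((isIso_homOfVector_iff p (B.U i) fun k : ULift.{u} (Fin r) => B.t i k.down).mp
    (B.isIso_chart i)).reindex Equiv.ulift.symm

theorem res_t {p : E ⟶ X} {z : X ⟶ E} (B : VectorBundleStructure p z r) (i j : B.ι) (k : Fin r) :
    res (p.preimage_mono inf_le_right) (B.t j k) = ∑ l, pb p le_rfl
      ((B.g i j : Matrix (Fin r) (Fin r) Γ(X, B.U i ⊓ B.U j)) k l) *
        res (p.preimage_mono inf_le_left) (B.t i l) := by
  refine (B.transition i j k).trans (Finset.sum_congr rfl fun l _ => ?_)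
  rw [app_eq_pb]; rfl

theorem zero_preimage {p : E ⟶ X} {z : X ⟶ E} (hz : z ≫ p = 𝟙 X) (U : X.Opens) :
    U ≤ z ⁻¹ᵁ p ⁻¹ᵁ U := by
  change U ≤ (z ≫ p) ⁻¹ᵁ U
  rw [hz]; exact le_rfl

theorem pb_zero_t {p : E ⟶ X} {z : X ⟶ E} (B : VectorBundleStructure p z r) (i : B.ι)
    (k : Fin r) {V : X.Opens} (e : V ≤ z ⁻¹ᵁ p ⁻¹ᵁ B.U i) : pb z e (B.t i k) = 0 := by
  have h := B.zero_coord i k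
  rw [app_eq_pb] at h
  rw [← res_pb z le_rfl e, h, map_zero]

/-- Construction of a vector bundle structure from charts. -/
def ofCharts {p : E ⟶ X} {z : X ⟶ E} (hz : z ≫ p = 𝟙 X) {ι : Type u} (U : ι → X.Opens)
    (hU : ⨆ i, U i = ⊤) (t : ∀ i, Fin r → Γ(E, p ⁻¹ᵁ U i)) (ht : ∀ i, IsChart p (U i) (t i))
    (g : ∀ i j, Matrix.GeneralLinearGroup (Fin r) Γ(X, U i ⊓ U j))
    (hg : ∀ i j k, res (p.preimage_mono inf_le_right) (t j k) = ∑ l, pb p le_rfl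
      ((g i j : Matrix (Fin r) (Fin r) Γ(X, U i ⊓ U j)) k l) *
        res (p.preimage_mono inf_le_left) (t i l))
    (h0 : ∀ i k, pb z (zero_preimage hz (U i)) (t i k) = 0) : VectorBundleStructure p z r where
  ι := ι
  U := U
  iSup_U := hU
  t := t
  isIso_chart i := (isIso_homOfVector_iff p (U i) fun k : ULift.{u} (Fin r) => t i k.down).mpr
    ((ht i).reindex Equiv.ulift)
  g := g
  transition i j k := (hg i j k).trans (Finset.sum_congr rfl fun l _ => by rw [app_eq_pb]; rfl)
  zero_proj := hz
  zero_coord i k := by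
    have e : z ⁻¹ᵁ p ⁻¹ᵁ U i ≤ U i := by
      change (z ≫ p) ⁻¹ᵁ U i ≤ U i
      rw [hz]; exact le_rfl
    rw [app_eq_pb, ← res_pb z (zero_preimage hz (U i)) e, h0, map_zero]

/-- The base change of a vector bundle. -/
def baseChange {p : E ⟶ X} {z : X ⟶ E} (B : VectorBundleStructure p z r) {s : Y ⟶ X} {q : P ⟶ Y}
    {s' : P ⟶ E} (H : IsPullback s' q p s) {z' : Y ⟶ P} (h1 : z' ≫ q = 𝟙 Y)
    (h2 : z' ≫ s' = s ≫ z) : VectorBundleStructure q z' r :=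
  ofCharts h1 (fun i => s ⁻¹ᵁ B.U i)
    (by
      refine top_le_iff.mp fun y _ => ?_
      have : s y ∈ ⨆ i, B.U i := by rw [B.iSup_U]; trivial
      obtain ⟨i, hi⟩ := TopologicalSpace.Opens.mem_iSup.mp this
      exact TopologicalSpace.Opens.mem_iSup.mpr ⟨i, hi⟩)
    (fun i k => pb s' (preimage_le_of_isPullback H (B.U i)) (B.t i k))
    (fun i => (B.isChart i).baseChange H)
    (fun i j => (B.g i j).map (pb s (le_refl (s ⁻¹ᵁ (B.U i ⊓ B.U j)))))
    (fun i j k => by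
      have e : q ⁻¹ᵁ (s ⁻¹ᵁ B.U i ⊓ s ⁻¹ᵁ B.U j) ≤ s' ⁻¹ᵁ p ⁻¹ᵁ (B.U i ⊓ B.U j) :=
        preimage_le_of_isPullback H (B.U i ⊓ B.U j)
      have h := congrArg (pb s' e) (B.res_t i j k)
      rw [pb_res, map_sum] at h
      rw [res_pb, h]
      refine Finset.sum_congr rfl fun l _ => ?_
      rw [map_mul, pb_res, res_pb, pb_pb, pb_congr H.w]
      congr 1
      exact (pb_pb q s le_rfl le_rfl _).symm)
    (fun i k => by
      rw [pb_pb, pb_congr h2, ← pb_pb s z (zero_preimage B.zero_proj _) le_rfl, B.pb_zero_t,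
        map_zero])

end VectorBundleStructure

/-! ### Linear coordinates of line bundles -/

section LineBundle

variable {E P : Scheme.{u}} {q : P ⟶ E} {z : E ⟶ P}

theorem IsChart.exists_section {W : E.Opens} {n : Type*} {t : n → Γ(P, q ⁻¹ᵁ W)}
    (h : IsChart q W t) (c : n → Γ(E, W)) : ∃ (σ : W.toScheme ⟶ P) (e : ⊤ ≤ σ ⁻¹ᵁ q ⁻¹ᵁ W),
      σ ≫ q = W.ι ∧ ∀ k, pb σ e (t k) = pb W.ι (top_le_ι_preimage W) (c k) :=
  h.exists_lift W.ι (top_le_ι_preimage W) _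

/-- Restrict to the section of `q` on which `t = 1`. -/
theorem IsChart.mul_right_cancel {W : E.Opens} {t : Γ(P, q ⁻¹ᵁ W)}
    (h : IsChart q W fun _ : Fin 1 => t) {a b : Γ(E, W)}
    (hab : pb q le_rfl a * t = pb q le_rfl b * t) : a = b := by
  obtain ⟨σ, e, h1, h2⟩ := h.exists_section fun _ => 1
  apply pb_ι_injective
  have := congrArg (pb σ e) hab
  rw [map_mul, map_mul, h2 0, map_one, mul_one, mul_one, pb_pb, pb_pb, pb_congr h1,
    pb_congr h1] at this
  exact this

namespace VectorBundleStructure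

variable (L : VectorBundleStructure q z 1)

/-- The fibre coordinate of a line bundle. -/
def coord (i : L.ι) : Γ(P, q ⁻¹ᵁ L.U i) := L.t i 0

/-- The transition function of a line bundle. -/
def ratio (i j : L.ι) : Γ(E, L.U i ⊓ L.U j) :=
  (L.g i j : Matrix (Fin 1) (Fin 1) Γ(E, L.U i ⊓ L.U j)) 0 0

theorem isUnit_ratio (i j : L.ι) : IsUnit (L.ratio i j) := by
  have := (Matrix.isUnit_iff_isUnit_det _).mp (L.g i j).isUnit
  rwa [Matrix.det_fin_one] at this

theorem isChart_coord (i : L.ι) : IsChart q (L.U i) fun _ : Fin 1 => L.coord i := by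
  have := L.isChart i
  have h : (fun _ : Fin 1 => L.coord i) = L.t i := by
    funext k; rw [Subsingleton.elim k 0]; rfl
  rwa [h]

theorem res_coord (i j : L.ι) {W : E.Opens} (hi : W ≤ L.U i) (hj : W ≤ L.U j) :
    res (q.preimage_mono hj) (L.coord j) =
      pb q le_rfl (res (le_inf hi hj) (L.ratio i j)) * res (q.preimage_mono hi) (L.coord i) := by
  have h := congrArg (res (q.preimage_mono (le_inf hi hj))) (L.res_t i j 0)
  rw [Fin.sum_univ_one, map_mul, res_res, res_res, res_pb] at h
  rw [pb_res]
  exact h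

/-- The cocycle condition is not part of the bundle data; it follows because the fibre coordinate
can be cancelled. -/
theorem res_ratio (i j k : L.ι) {W : E.Opens} (hi : W ≤ L.U i) (hj : W ≤ L.U j)
    (hk : W ≤ L.U k) : res (le_inf hi hk) (L.ratio i k) =
      res (le_inf hj hk) (L.ratio j k) * res (le_inf hi hj) (L.ratio i j) := by
  apply ((L.isChart_coord i).restrict hi).mul_right_cancel
  rw [← L.res_coord i k hi hk, map_mul, mul_assoc, ← L.res_coord i j hi hj, ← L.res_coord j k hj hk]

/-- The function `w` on the preimage of the open subset `W` is linear on fibres and vanishes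
nowhere off the zero section. -/
def IsLinCoord (W : E.Opens) (w : Γ(P, q ⁻¹ᵁ W)) : Prop :=
  ∀ y ∈ W, ∃ (i : L.ι) (N : E.Opens) (hN : N ≤ W) (hi : N ≤ L.U i), y ∈ N ∧ ∃ c : Γ(E, N),
    IsUnit c ∧ res (q.preimage_mono hN) w =
      pb q le_rfl c * res (q.preimage_mono hi) (L.coord i)

variable {L}

theorem IsLinCoord.isChart {W : E.Opens} {w : Γ(P, q ⁻¹ᵁ W)} (h : L.IsLinCoord W w) :
    IsChart q W fun _ : Fin 1 => w := by
  refine IsChart.of_locally _ fun y hy => ?_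
  obtain ⟨i, N, hN, hi, hyN, c, hc, hw⟩ := h y hy
  refine ⟨N, hN, hyN, ?_⟩
  have := ((L.isChart_coord i).restrict hi).unit_mul c hc
  rwa [← hw] at this

theorem IsLinCoord.restrict {W W' : E.Opens} {w : Γ(P, q ⁻¹ᵁ W)} (h : L.IsLinCoord W w)
    (hW : W' ≤ W) : L.IsLinCoord W' (res (q.preimage_mono hW) w) := by
  intro y hy
  obtain ⟨i, N, hN, hi, hyN, c, hc, hw⟩ := h y (hW hy)
  refine ⟨i, N ⊓ W', inf_le_right, inf_le_left.trans hi, ⟨hyN, hy⟩, res inf_le_left c, hc.map _, ?_⟩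
  have := congrArg (res (q.preimage_mono (inf_le_left : N ⊓ W' ≤ N))) hw
  rw [res_res, map_mul, res_res, res_pb] at this
  rw [res_res, pb_res, this]

theorem IsLinCoord.exists_local_unit {W : E.Opens} {w w' : Γ(P, q ⁻¹ᵁ W)} (h : L.IsLinCoord W w)
    (h' : L.IsLinCoord W w') (y : E) (hy : y ∈ W) :
    ∃ (N : E.Opens) (hN : N ≤ W), y ∈ N ∧ ∃ c : Γ(E, N),
      IsUnit c ∧ res (q.preimage_mono hN) w' = pb q le_rfl c * res (q.preimage_mono hN) w := by
  obtain ⟨i, N, hN, hi, hyN, c, hc, hw⟩ := h y hy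
  obtain ⟨i', N', hN', hi', hyN', c', hc', hw'⟩ := h' y hy
  have l1 : N ⊓ N' ≤ N := inf_le_left
  have l2 : N ⊓ N' ≤ N' := inf_le_right
  obtain ⟨v, hv⟩ := hc.map (res l1)
  have hu : IsUnit (res (le_inf (l1.trans hi) (l2.trans hi')) (L.ratio i i')) :=
    (L.isUnit_ratio i i').map _
  refine ⟨N ⊓ N', l1.trans hN, ⟨hyN, hyN'⟩,
    res l2 c' * res (le_inf (l1.trans hi) (l2.trans hi')) (L.ratio i i') * ↑v⁻¹,
    ((hc'.map _).mul hu).mul v⁻¹.isUnit, ?_⟩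
  have e1 := congrArg (res (q.preimage_mono l1)) hw
  have e2 := congrArg (res (q.preimage_mono l2)) hw'
  rw [res_res, map_mul, res_res, res_pb, ← pb_res q le_rfl l1, ← hv] at e1
  rw [res_res, map_mul, res_res, res_pb, ← pb_res q le_rfl l2,
    L.res_coord i i' (l1.trans hi) (l2.trans hi')] at e2
  rw [e1, e2, map_mul, map_mul]
  have : pb q (le_refl (q ⁻¹ᵁ (N ⊓ N'))) (↑v⁻¹ : Γ(E, N ⊓ N')) * pb q le_rfl (↑v : Γ(E, N ⊓ N')) = 1 := by
    rw [← map_mul, Units.inv_mul, map_one]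
  linear_combination (-(pb q le_rfl (res l2 c')) * pb q le_rfl
    (res (le_inf (l1.trans hi) (l2.trans hi')) (L.ratio i i')) *
    res (q.preimage_mono (l1.trans hi)) (L.coord i)) * this

theorem IsLinCoord.exists_unit {W : E.Opens} {w w' : Γ(P, q ⁻¹ᵁ W)} (h : L.IsLinCoord W w)
    (h' : L.IsLinCoord W w') : ∃ c : Γ(E, W), IsUnit c ∧ w' = pb q le_rfl c * w := by
  obtain ⟨σ, e, h1, h2⟩ := h.isChart.exists_section fun _ => 1
  replace h2 := h2 0
  rw [map_one] at h2
  -- On the section `σ`, where `w = 1`, any local factor `v` with `w' = v w` equals `w'`; hence `c`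
  -- is `w'` restricted to `σ`, and the local factors are its restrictions.
  let c : Γ(E, W) := W.topIso.hom (pb σ e w')
  have hc : pb W.ι (top_le_ι_preimage W) c = pb σ e w' := by
    rw [pb_ι_eq_topIso_inv]
    simp only [c, ← CommRingCat.comp_apply, Iso.hom_inv_id]
    rfl
  have key : ∀ (N : E.Opens) (hN : N ≤ W) (v : Γ(E, N)),
      res (q.preimage_mono hN) w' = pb q le_rfl v * res (q.preimage_mono hN) w → res hN c = v := by
    intro N hN v hv
    apply pb_ι_injective
    let j : N.toScheme ⟶ W.toScheme := E.homOfLE hN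
    have hj : j ≫ W.ι = N.ι := Scheme.homOfLE_ι _ _
    have e3 : ⊤ ≤ (j ≫ σ) ⁻¹ᵁ q ⁻¹ᵁ N := by
      change ⊤ ≤ ((j ≫ σ) ≫ q) ⁻¹ᵁ N
      rw [Category.assoc, h1, hj]
      exact top_le_ι_preimage N
    have h4 := congrArg (pb (j ≫ σ) e3) hv
    rw [map_mul, pb_res, pb_res, pb_pb] at h4
    have h5 : pb (j ≫ σ) (e3.trans ((j ≫ σ).preimage_mono (q.preimage_mono hN))) w = 1 :=
      (pb_pb j σ e (U := ⊤) le_top w).symm.trans (by rw [h2, map_one])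
    have h6 : pb (j ≫ σ) (e3.trans ((j ≫ σ).preimage_mono (q.preimage_mono hN))) w' =
        pb N.ι (top_le_ι_preimage N) (res hN c) := by
      rw [pb_res]
      refine (pb_pb j σ e (U := ⊤) le_top w').symm.trans ?_
      rw [← hc]
      exact (pb_pb j W.ι _ _ c).trans (pb_congr hj _ _)
    rw [h5, h6, mul_one] at h4
    rw [h4]
    exact pb_congr (by rw [Category.assoc, h1, hj]) _ _
  refine ⟨c, isUnit_of_locally _ fun y hy => ?_, fun_ext_of_locally _ _ fun x hx => ?_⟩
  · obtain ⟨N, hN, hyN, v, hv, hvw⟩ := h.exists_local_unit h' y hy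
    exact ⟨N, hN, hyN, by rwa [key N hN v hvw]⟩
  · obtain ⟨N, hN, hyN, v, hv, hvw⟩ := h.exists_local_unit h' (q x) hx
    refine ⟨q ⁻¹ᵁ N, q.preimage_mono hN, hyN, ?_⟩
    rw [hvw, map_mul, res_pb, ← key N hN v hvw, pb_res]

theorem IsLinCoord.pb_zero {W : E.Opens} {w : Γ(P, q ⁻¹ᵁ W)} (h : L.IsLinCoord W w)
    {V : E.Opens} (e : V ≤ z ⁻¹ᵁ q ⁻¹ᵁ W) : pb z e w = 0 := by
  have hV : V ≤ W := by
    have : V ≤ (z ≫ q) ⁻¹ᵁ W := e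
    rwa [L.zero_proj] at this
  refine fun_ext_of_locally _ _ fun y hy => ?_
  obtain ⟨i, N, hN, hi, hyN, c, hc, hw⟩ := h y (hV hy)
  refine ⟨V ⊓ N, inf_le_left, ⟨hy, hyN⟩, ?_⟩
  have e' : V ⊓ N ≤ z ⁻¹ᵁ q ⁻¹ᵁ N := inf_le_right.trans (zero_preimage L.zero_proj N)
  have := congrArg (pb z e') hw
  rw [pb_res, map_mul, pb_res, show L.coord i = L.t i 0 from rfl, L.pb_zero_t, mul_zero] at this
  rw [res_pb, this, map_zero]

end VectorBundleStructure

end LineBundle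

/-! ### Functions on vector bundles -/

section Affine

variable {E X : Scheme.{u}}

/-- Polynomials in the fibre coordinates. -/
def polyFun (p : E ⟶ X) (V : X.Opens) {σ : Type*} (t : σ → Γ(E, p ⁻¹ᵁ V)) :
    MvPolynomial σ Γ(X, V) →+* Γ(E, p ⁻¹ᵁ V) :=
  MvPolynomial.eval₂Hom (pb p le_rfl) t

theorem bijective_appTop {S T : Scheme.{u}} (φ : S ⟶ T) [IsIso φ] :
    Function.Bijective φ.appTop := by
  have : IsIso φ.appTop := inferInstanceAs (IsIso (φ.app ⊤))
  exact ConcreteCategory.bijective_of_isIso φ.appTop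

theorem IsChart.isAffineOpen {p : E ⟶ X} {V : X.Opens} {σ : Type u} {t : σ → Γ(E, p ⁻¹ᵁ V)}
    (h : IsChart p V t) (hV : IsAffineOpen V) : IsAffineOpen (p ⁻¹ᵁ V) := by
  have := (isIso_homOfVector_iff p V t).mpr h
  have : IsAffine V := hV
  exact IsAffine.of_isIso (AffineSpace.homOfVector (p ∣_ V) fun k => (p ⁻¹ᵁ V).topIso.inv (t k))

theorem IsChart.isIntegral {p : E ⟶ X} {V : X.Opens} {σ : Type u} {t : σ → Γ(E, p ⁻¹ᵁ V)}
    (h : IsChart p V t) [IsIntegral V] : IsIntegral ((p ⁻¹ᵁ V).toScheme) := by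
  have := (isIso_homOfVector_iff p V t).mpr h
  exact IsIntegral.of_isIso
    (inv (AffineSpace.homOfVector (p ∣_ V) fun k => (p ⁻¹ᵁ V).topIso.inv (t k)))

/-- The chart identifies `p⁻¹(V)` with affine space over the affine `V`, whose ring of functions is
a polynomial ring. -/
theorem IsChart.bijective_polyFun {p : E ⟶ X} {V : X.Opens} {σ : Type u} {t : σ → Γ(E, p ⁻¹ᵁ V)}
    (h : IsChart p V t) (hV : IsAffineOpen V) : Function.Bijective (polyFun p V t) := by
  have := (isIso_homOfVector_iff p V t).mpr h
  have : IsAffine V := hV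
  set φ := AffineSpace.homOfVector (p ∣_ V) fun k => (p ⁻¹ᵁ V).topIso.inv (t k) with hφ
  have hover : φ ≫ (AffineSpace σ V ↘ V.toScheme) = p ∣_ V := AffineSpace.homOfVector_over _ _
  have hcoord : ∀ k, φ.appTop (AffineSpace.coord _ k) = (p ⁻¹ᵁ V).topIso.inv (t k) :=
    AffineSpace.homOfVector_appTop_coord _ _
  let ψ : MvPolynomial σ Γ(V, ⊤) →+* Γ(AffineSpace σ V, ⊤) :=
    MvPolynomial.eval₂Hom ((AffineSpace σ V ↘ V.toScheme).appTop).hom (AffineSpace.coord _)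
  have hψ : Function.Bijective ψ := by
    have h1 := bijective_appTop (AffineSpace.isoOfIsAffine σ V).hom
    rw [AffineSpace.isoOfIsAffine_hom_appTop] at h1
    have h2 := ConcreteCategory.bijective_of_isIso
      (Scheme.ΓSpecIso (.of (MvPolynomial σ Γ(V, ⊤)))).inv
    have h3 := h1.comp h2
    convert h3 using 1
    funext x
    exact congrArg ψ congr($((Scheme.ΓSpecIso (.of (MvPolynomial σ Γ(V, ⊤)))).inv_hom_id).hom x).symm
  have hφ' := bijective_appTop φ
  have htop := ConcreteCategory.bijective_of_isIso (p ⁻¹ᵁ V).topIso.inv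
  have hmap : Function.Bijective (MvPolynomial.map (σ := σ) V.topIso.inv.hom) :=
    (MvPolynomial.mapEquiv σ V.topIso.symm.commRingCatIsoToRingEquiv).bijective
  have key : (p ⁻¹ᵁ V).topIso.inv.hom.comp (polyFun p V t) =
      (φ.appTop.hom.comp ψ).comp (MvPolynomial.map (σ := σ) V.topIso.inv.hom) := by
    apply MvPolynomial.ringHom_ext
    · intro a
      simp only [polyFun, RingHom.comp_apply, MvPolynomial.coe_eval₂Hom, MvPolynomial.eval₂_C, ψ,
        MvPolynomial.map_C]
      have e1 := comp_appTop_apply φ (AffineSpace σ V ↘ V.toScheme) (V.topIso.inv a)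
      rw [hover] at e1
      refine Eq.trans ?_ e1
      have e2 := appTop_topIso_inv (p ∣_ V) (fun x _ => ((p ∣_ V) x).2) a
      refine Eq.trans ?_ e2.symm
      refine (pb_ι_eq_topIso_inv (p ⁻¹ᵁ V) _).symm.trans ?_
      rw [pb_pb]
      exact pb_congr (morphismRestrict_ι _ _).symm _ _
    · intro k
      simp only [polyFun, RingHom.comp_apply, MvPolynomial.coe_eval₂Hom, MvPolynomial.eval₂_X, ψ,
        MvPolynomial.map_X]
      exact (hcoord k).symm
  have hcomp : Function.Bijective ((p ⁻¹ᵁ V).topIso.inv.hom.comp (polyFun p V t)) := by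
    rw [key]
    exact (hφ'.comp hψ).comp hmap
  exact (Function.Bijective.of_comp_iff' htop _).mp hcomp

theorem pb_zero_pb {p : E ⟶ X} {z : X ⟶ E} (hz : z ≫ p = 𝟙 X) {V : X.Opens} (a : Γ(X, V)) :
    pb z (VectorBundleStructure.zero_preimage hz V) (pb p le_rfl a) = a :=
  (pb_pb _ _ _ _ a).trans ((pb_congr hz _ a).trans ((pb_id _ a).trans (res_self _ a)))

theorem pb_polyFun {p : E ⟶ X} {z : X ⟶ E} (hz : z ≫ p = 𝟙 X) {V : X.Opens} {σ : Type*}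
    (t : σ → Γ(E, p ⁻¹ᵁ V))
    (ht : ∀ k, pb z (VectorBundleStructure.zero_preimage hz V) (t k) = 0)
    (f : MvPolynomial σ Γ(X, V)) : pb z (VectorBundleStructure.zero_preimage hz V)
      (polyFun p V t f) = MvPolynomial.constantCoeff f := by
  have : (pb z (VectorBundleStructure.zero_preimage hz V)).comp (polyFun p V t) =
      MvPolynomial.constantCoeff := by
    apply MvPolynomial.ringHom_ext
    · intro a
      simp only [polyFun, RingHom.comp_apply, MvPolynomial.coe_eval₂Hom, MvPolynomial.eval₂_C,
        MvPolynomial.constantCoeff_C]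
      exact pb_zero_pb hz a
    · intro k
      simp only [polyFun, RingHom.comp_apply, MvPolynomial.coe_eval₂Hom, MvPolynomial.eval₂_X,
        MvPolynomial.constantCoeff_X, ht]
  exact congr($this f)

end Affine

/-! ### Total spaces of vector bundles over integral schemes -/

namespace VectorBundleStructure

variable {E X : Scheme.{u}} {p : E ⟶ X} {z : X ⟶ E} {r : ℕ}

/-- The fibre coordinates over a smaller open subset. -/
def tRes (B : VectorBundleStructure p z r) (i : B.ι) {V : X.Opens} (h : V ≤ B.U i)
    (k : ULift.{u} (Fin r)) : Γ(E, p ⁻¹ᵁ V) := res (p.preimage_mono h) (B.t i k.down)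

theorem isChart_tRes (B : VectorBundleStructure p z r) (i : B.ι) {V : X.Opens} (h : V ≤ B.U i) :
    IsChart p V (B.tRes i h) :=
  ((B.isChart i).restrict h).reindex Equiv.ulift

theorem pb_zero_tRes (B : VectorBundleStructure p z r) (i : B.ι) {V : X.Opens} (h : V ≤ B.U i)
    (k : ULift.{u} (Fin r)) : pb z (zero_preimage B.zero_proj V) (B.tRes i h k) = 0 := by
  rw [tRes, pb_res, B.pb_zero_t]

theorem exists_mem_U (B : VectorBundleStructure p z r) (x : X) : ∃ i, x ∈ B.U i := by
  have : x ∈ ⨆ i, B.U i := by rw [B.iSup_U]; trivial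
  exact TopologicalSpace.Opens.mem_iSup.mp this

theorem exists_affine_nhds (B : VectorBundleStructure p z r) (x : X) (W : X.Opens) (hW : x ∈ W) :
    ∃ (i : B.ι) (V : X.Opens) (_ : V ≤ B.U i), IsAffineOpen V ∧ x ∈ V ∧ V ≤ W := by
  obtain ⟨i, hi⟩ := B.exists_mem_U x
  obtain ⟨_, ⟨V, hV, rfl⟩, hxV, hVU⟩ :=
    X.isBasis_affineOpens.exists_subset_of_mem_open (show x ∈ (B.U i ⊓ W : X.Opens) from ⟨hi, hW⟩)
      (B.U i ⊓ W).isOpen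
  exact ⟨i, V, fun y hy => (hVU hy).1, hV, hxV, fun y hy => (hVU hy).2⟩

theorem isIntegral [IsIntegral X] (B : VectorBundleStructure p z r) : IsIntegral E := by
  have hU : ∀ i (_ : (B.U i : Set X).Nonempty), IsIntegral (p ⁻¹ᵁ B.U i).toScheme := by
    rintro i ⟨x, hx⟩
    have : Nonempty (B.U i) := ⟨⟨x, hx⟩⟩
    exact (B.isChart_tRes i le_rfl).isIntegral
  have hred : IsReduced E := by
    have : ∀ y : E, _root_.IsReduced (E.presheaf.stalk y) := by
      intro y
      obtain ⟨i, hi⟩ := B.exists_mem_U (p y)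
      have := hU i ⟨_, hi⟩
      have h1 : _root_.IsReduced ((p ⁻¹ᵁ B.U i).toScheme.presheaf.stalk ⟨y, hi⟩) :=
        isReduced_stalk_of_isReduced _ _
      exact isReduced_of_injective _
        (((p ⁻¹ᵁ B.U i).stalkIso ⟨y, hi⟩).symm.commRingCatIsoToRingEquiv).injective
    exact isReduced_of_isReduced_stalk E
  have hirr : ∀ i (_ : (B.U i : Set X).Nonempty), IsPreirreducible ((p ⁻¹ᵁ B.U i : E.Opens) : Set E) := by
    intro i hi
    have := hU i hi
    exact (isIrreducible_iff_irreducibleSpace.mpr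
      (inferInstance : IrreducibleSpace (p ⁻¹ᵁ B.U i).toScheme)).isPreirreducible
  -- Each chart domain is irreducible, and two of them meet along the zero section because their
  -- bases meet in `X`.
  have hpre : PreirreducibleSpace E := by
    constructor
    rintro u v hu hv ⟨a, -, ha⟩ ⟨b, -, hb⟩
    obtain ⟨i, hi⟩ := B.exists_mem_U (p a)
    obtain ⟨j, hj⟩ := B.exists_mem_U (p b)
    obtain ⟨x, hxi, hxj⟩ := nonempty_preirreducible_inter (B.U i).isOpen (B.U j).isOpen
      ⟨_, hi⟩ ⟨_, hj⟩
    have hzx : p (z x) = x := by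
      have := congr($(B.zero_proj) x)
      simpa using this
    obtain ⟨c, hci, hcu, hcj⟩ := hirr i ⟨_, hi⟩ u (p ⁻¹ᵁ B.U j) hu (p ⁻¹ᵁ B.U j).isOpen
      ⟨a, hi, ha⟩ ⟨z x, by simpa [hzx] using hxi, by simpa [hzx] using hxj⟩
    obtain ⟨d, -, hdu, hdv⟩ := hirr j ⟨_, hj⟩ u v hu hv ⟨c, hcj, hcu⟩ ⟨b, hj, hb⟩
    exact ⟨d, trivial, hdu, hdv⟩
  have : IrreducibleSpace E := ⟨⟨z (genericPoint X)⟩⟩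
  exact isIntegral_of_irreducibleSpace_of_isReduced E

/-- Invertible functions on a vector bundle over an integral scheme are constant on fibres. -/
theorem eq_pb_of_isUnit [IsIntegral X] (B : VectorBundleStructure p z r) {W : X.Opens}
    (u : Γ(E, p ⁻¹ᵁ W)) (hu : IsUnit u) : ∃ c : Γ(X, W), IsUnit c ∧ u = pb p le_rfl c := by
  refine ⟨pb z (zero_preimage B.zero_proj W) u, hu.map _, fun_ext_of_locally _ _ fun y hy => ?_⟩
  obtain ⟨i, V, hi, hV, hyV, hVW⟩ := B.exists_affine_nhds (p y) W hy
  refine ⟨p ⁻¹ᵁ V, p.preimage_mono hVW, hyV, ?_⟩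
  have : Nonempty V := ⟨⟨_, hyV⟩⟩
  have hbij := (B.isChart_tRes i hi).bijective_polyFun hV
  let θ := RingEquiv.ofBijective _ hbij
  obtain ⟨f, hf⟩ := θ.surjective (res (p.preimage_mono hVW) u)
  have hfu : IsUnit f := by
    rw [← MulEquiv.isUnit_map θ, hf]
    exact hu.map _
  -- Units of a polynomial ring over a reduced ring here reduce to constants, since `Γ(X, V)` is a
  -- domain.
  obtain ⟨a, -, rfl⟩ := MvPolynomial.isUnit_iff_eq_C_of_isReduced.mp hfu
  have h1 : res (p.preimage_mono hVW) u = pb p le_rfl a := by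
    rw [← hf]
    exact MvPolynomial.eval₂_C _ _ _
  rw [res_pb, h1, ← pb_res p le_rfl hVW, res_pb, ← pb_res z (zero_preimage B.zero_proj V)
    (p.preimage_mono hVW), h1, pb_zero_pb B.zero_proj]

end VectorBundleStructure

/-! ### Rational functions on integral schemes -/

section RationalFunctions

variable {E : Scheme.{u}}

theorem genericPoint_mem [IrreducibleSpace E] {V : E.Opens} (h : (V : Set E).Nonempty) :
    genericPoint E ∈ V :=
  ((genericPoint_spec E).mem_open_set_iff V.isOpen).mpr (by simpa using h)

theorem inf_nonempty [IrreducibleSpace E] {V V' : E.Opens} (h : (V : Set E).Nonempty)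
    (h' : (V' : Set E).Nonempty) : ((V ⊓ V' : E.Opens) : Set E).Nonempty :=
  ⟨genericPoint E, genericPoint_mem h, genericPoint_mem h'⟩

theorem isUnit_res_basicOpen {W : E.Opens} (f : Γ(E, W)) :
    IsUnit (res (E.basicOpen_le f) f) := E.toRingedSpace.isUnit_res_basicOpen f

variable [IsIntegral E]

/-- The rational function given by a function on a nonempty open subset. -/
def rat (V : E.Opens) (h : (V : Set E).Nonempty) : Γ(E, V) →+* E.functionField :=
  (E.presheaf.germ V (genericPoint E) (genericPoint_mem h)).hom

theorem rat_res {V V' : E.Opens} (h : (V : Set E).Nonempty) (h' : (V' : Set E).Nonempty)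
    (e : V' ≤ V) (f : Γ(E, V)) : rat V' h' (res e f) = rat V h f :=
  E.presheaf.germ_res_apply (homOfLE e) _ (genericPoint_mem h') f

theorem rat_injective (V : E.Opens) (h : (V : Set E).Nonempty) : Function.Injective (rat V h) :=
  germ_injective_of_isIntegral _ _ _

theorem basicOpen_nonempty {V : E.Opens} {f : Γ(E, V)} (hf : f ≠ 0) :
    (E.basicOpen f : Set E).Nonempty := by
  by_contra h
  apply hf
  rw [← basicOpen_eq_bot_iff]
  exact TopologicalSpace.Opens.ext (Set.not_nonempty_iff_eq_empty.mp h)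

/-- Clearing denominators. Allowing every larger exponent lets one `N` serve finitely many
functions. -/
theorem exists_pow_mul_rat_eq {W : E.Opens} (hW : IsAffineOpen W) (hne : (W : Set E).Nonempty)
    (f : Γ(E, W)) (hD : (E.basicOpen f : Set E).Nonempty) (x : Γ(E, E.basicOpen f)) :
    ∃ n, ∀ N, n ≤ N → ∃ y, rat W hne y = rat W hne f ^ N * rat _ hD x := by
  obtain ⟨n, y, hy⟩ := exists_eq_pow_mul_of_isAffineOpen E W hW f x
  replace hy : res (E.basicOpen_le f) y = res (E.basicOpen_le f) f ^ n * x := hy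
  refine ⟨n, fun N hN => ⟨f ^ (N - n) * y, ?_⟩⟩
  have := congrArg (rat _ hD) hy
  rw [map_mul, map_pow, rat_res hne hD, rat_res hne hD] at this
  rw [map_mul, map_pow, this, ← mul_assoc, ← pow_add, Nat.sub_add_cancel hN]

end RationalFunctions

/-! ### Line bundles over vector bundles -/

section LinCoord

variable {E P : Scheme.{u}} {q : P ⟶ E} {z : E ⟶ P}

/-- The transition functions of `L` form a coboundary on the basic open sets of the `b k`: clearing
denominators turns them into a rank one matrix over `A[X]`, which `exists_factor_mvPolynomial`
splits. The hypothesis on `b k₀` supplies the unit constant term. -/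
theorem VectorBundleStructure.exists_units (L : VectorBundleStructure q z 1) [IsIntegral E]
    {A σ κ : Type*} [CommRing A] [IsDomain A] [IsIntegrallyClosed A] [Finite κ] {W : E.Opens}
    (hW : IsAffineOpen W) (θ : MvPolynomial σ A ≃+* Γ(E, W)) (b : κ → Γ(E, W)) (j : κ → L.ι)
    (hb : ∀ k, b k ≠ 0) (hD : ∀ k, E.basicOpen (b k) ≤ L.U (j k)) (k₀ : κ)
    (hk₀ : IsUnit (MvPolynomial.constantCoeff (θ.symm (b k₀)))) :
    ∃ c : ∀ k, Γ(E, E.basicOpen (b k)), (∀ k, IsUnit (c k)) ∧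
      ∀ (k l : κ) (N : E.Opens) (hk : N ≤ E.basicOpen (b k)) (hl : N ≤ E.basicOpen (b l)),
        res hk (c k) * res (le_inf (hl.trans (hD l)) (hk.trans (hD k))) (L.ratio (j l) (j k)) =
          res hl (c l) := by
  have := Fintype.ofFinite κ
  have hDne : ∀ k, (E.basicOpen (b k) : Set E).Nonempty := fun k => basicOpen_nonempty (hb k)
  have hWne : (W : Set E).Nonempty := (hDne k₀).mono (E.basicOpen_le _)
  have hUne : ∀ k, (L.U (j k) : Set E).Nonempty := fun k => (hDne k).mono (hD k)
  have : Nonempty W := ⟨⟨_, hWne.some_mem⟩⟩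
  have hfrac := functionField_isFractionRing_of_isAffineOpen E W hW
  let _ : Algebra (MvPolynomial σ A) E.functionField := ((rat W hWne).comp θ.toRingHom).toAlgebra
  have halg : ∀ x, algebraMap (MvPolynomial σ A) E.functionField x = rat W hWne (θ x) :=
    fun _ => rfl
  have : IsFractionRing (MvPolynomial σ A) E.functionField :=
    IsFractionRing.of_ringEquiv_left θ fun _ => rfl
  have hne2 := fun k l => inf_nonempty (hUne k) (hUne l)
  -- Using `k₀` as reference turns the cocycle into quotients `ψ k / ψ l` of rational functions.
  let ψ : κ → E.functionField := fun k => rat _ (hne2 k₀ k) (L.ratio (j k₀) (j k))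
  have hψ : ∀ k, ψ k ≠ 0 := fun k => ((L.isUnit_ratio _ _).map (rat _ (hne2 k₀ k))).ne_zero
  have hratio : ∀ k l, rat _ (hne2 l k) (L.ratio (j l) (j k)) = ψ k * (ψ l)⁻¹ := by
    intro k l
    have h3 := inf_nonempty (hne2 l k) (hUne k₀)
    have := congrArg (rat _ h3) (L.res_ratio (j k₀) (j l) (j k) (W := L.U (j l) ⊓ L.U (j k) ⊓ L.U (j k₀))
      inf_le_right (inf_le_left.trans inf_le_left) (inf_le_left.trans inf_le_right))
    rw [map_mul, rat_res (hne2 k₀ k) h3, rat_res (hne2 l k) h3, rat_res (hne2 k₀ l) h3] at this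
    rw [eq_mul_inv_iff_mul_eq₀ (hψ l)]
    exact this.symm
  let β : κ → E.functionField := fun k => rat W hWne (b k)
  have hβ : ∀ k, β k ≠ 0 := fun k => (map_ne_zero_iff _ (rat_injective W hWne)).mpr (hb k)
  have hpow : ∀ kl : κ × κ, ∃ n, ∀ N, n ≤ N → ∃ y, rat W hWne y =
      (β kl.1 * β kl.2) ^ N * (ψ kl.1 * (ψ kl.2)⁻¹) := by
    rintro ⟨k, l⟩
    have hle : E.basicOpen (b k * b l) ≤ L.U (j l) ⊓ L.U (j k) := by
      rw [Scheme.basicOpen_mul]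
      exact le_inf (inf_le_right.trans (hD l)) (inf_le_left.trans (hD k))
    have hne : (E.basicOpen (b k * b l) : Set E).Nonempty := by
      rw [Scheme.basicOpen_mul]
      exact inf_nonempty (hDne k) (hDne l)
    obtain ⟨n, hn⟩ := exists_pow_mul_rat_eq hW hWne (b k * b l) hne (res hle (L.ratio (j l) (j k)))
    rw [rat_res (hne2 l k) hne, map_mul, hratio] at hn
    exact ⟨n, hn⟩
  choose n hn using hpow
  let N := Finset.univ.sup n
  have hN : ∀ k l, ∃ y, rat W hWne y = (β k * β l) ^ N * (ψ k * (ψ l)⁻¹) := fun k l =>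
    hn (k, l) N (Finset.le_sup (Finset.mem_univ (k, l)))
  obtain ⟨d, hd, f, g, hf, hg⟩ := exists_factor_mvPolynomial (A := A) (σ := σ)
    (F := E.functionField) (fun l => β l ^ N * (ψ l)⁻¹) (fun k => β k ^ N * ψ k)
    (fun l k => by
      obtain ⟨y, hy⟩ := hN k l
      refine ⟨θ.symm y, ?_⟩
      rw [halg, θ.apply_symm_apply, hy]
      ring)
    k₀ ((θ.symm (b k₀)) ^ (2 * N))
    (by
      rw [halg, map_pow, θ.apply_symm_apply, map_pow]
      change β k₀ ^ N * (ψ k₀)⁻¹ * (β k₀ ^ N * ψ k₀) = β k₀ ^ (2 * N)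
      have := hψ k₀
      field_simp
      ring)
    (by rw [map_pow]; exact hk₀.pow _)
  simp only [halg] at hf hg
  have hfg : ∀ k, θ (f k) * θ (g k) = b k ^ (2 * N) := by
    intro k
    apply rat_injective W hWne
    rw [map_mul, map_pow]
    change _ = β k ^ (2 * N)
    have h1 : rat W hWne (θ (f k)) = d⁻¹ * (β k ^ N * (ψ k)⁻¹) := by
      rw [hf, inv_mul_cancel_left₀ hd]
    have h2 : rat W hWne (θ (g k)) = d * (β k ^ N * ψ k) := by
      rw [hg, mul_inv_cancel_left₀ hd]
    have := hψ k
    rw [h1, h2]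
    field_simp
    ring
  have hfu : ∀ k, IsUnit (res (E.basicOpen_le (b k)) (θ (f k))) := fun k => by
    refine isUnit_of_mul_isUnit_left (y := res (E.basicOpen_le (b k)) (θ (g k))) ?_
    rw [← map_mul, hfg, map_pow]
    exact (isUnit_res_basicOpen _).pow _
  choose v hv using fun k => (isUnit_res_basicOpen (b k)).pow N
  have hc : ∀ k, rat _ (hDne k) (res (E.basicOpen_le (b k)) (θ (f k)) * ↑(v k)⁻¹) =
      d⁻¹ * (ψ k)⁻¹ := by
    intro k
    have h1 : rat W hWne (θ (f k)) = d⁻¹ * (β k ^ N * (ψ k)⁻¹) := by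
      rw [hf, inv_mul_cancel_left₀ hd]
    have h2 := congrArg (rat _ (hDne k)) (v k).mul_inv
    rw [map_mul, hv, map_pow, rat_res hWne, map_one] at h2
    rw [map_mul, rat_res hWne, h1]
    change β k ^ N * _ = 1 at h2
    linear_combination (d⁻¹ * (ψ k)⁻¹) * h2
  -- As rational functions these are `d⁻¹ (ψ k)⁻¹`. They are units because `f k * g k = b k ^ (2 *
  -- N)`.
  refine ⟨fun k => res (E.basicOpen_le (b k)) (θ (f k)) * ↑(v k)⁻¹,
    fun k => (hfu k).mul (v k)⁻¹.isUnit, ?_⟩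
  intro k l M hk hl
  rcases (M : Set E).eq_empty_or_nonempty with hM | hM
  · have hM' : M = ⊥ := TopologicalSpace.Opens.ext hM
    subst hM'
    exact Subsingleton.elim _ _
  · apply rat_injective M hM
    rw [map_mul, rat_res (hDne k), rat_res (hDne l), rat_res (hne2 l k), hc, hc, hratio]
    have := hψ k
    field_simp

theorem VectorBundleStructure.exists_isLinCoord_of_units (L : VectorBundleStructure q z 1)
    {κ : Type*} {W : E.Opens} (D : κ → E.Opens) (hDW : ∀ k, D k ≤ W) (hWD : W ≤ ⨆ k, D k)
    (j : κ → L.ι) (hD : ∀ k, D k ≤ L.U (j k)) (c : ∀ k, Γ(E, D k)) (hc : ∀ k, IsUnit (c k))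
    (h : ∀ (k l : κ) (N : E.Opens) (hk : N ≤ D k) (hl : N ≤ D l),
        res hk (c k) * res (le_inf (hl.trans (hD l)) (hk.trans (hD k))) (L.ratio (j l) (j k)) =
          res hl (c l)) : ∃ w, L.IsLinCoord W w := by
  let s : ∀ k, Γ(P, q ⁻¹ᵁ D k) := fun k =>
    pb q le_rfl (c k) * res (q.preimage_mono (hD k)) (L.coord (j k))
  have hs : ∀ (k l : κ) (N : E.Opens) (hk : N ≤ D k) (hl : N ≤ D l),
      res (q.preimage_mono hk) (s k) = res (q.preimage_mono hl) (s l) := by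
    intro k l N hk hl
    simp only [s]
    rw [map_mul, map_mul, res_res, res_res, res_pb, res_pb,
      L.res_coord (j l) (j k) (hl.trans (hD l)) (hk.trans (hD k)), ← pb_res q le_rfl hk,
      ← pb_res q le_rfl hl, ← mul_assoc, ← map_mul, h k l N hk hl]
  obtain ⟨w, hw, -⟩ := P.sheaf.existsUnique_gluing' (fun k => q ⁻¹ᵁ D k) (q ⁻¹ᵁ W)
    (fun k => homOfLE (q.preimage_mono (hDW k)))
    (fun x hx => by
      obtain ⟨k, hk⟩ := TopologicalSpace.Opens.mem_iSup.mp (hWD hx)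
      exact TopologicalSpace.Opens.mem_iSup.mpr ⟨k, hk⟩)
    s (fun k l => hs k l (D k ⊓ D l) inf_le_left inf_le_right)
  refine ⟨w, fun y hy => ?_⟩
  obtain ⟨k, hk⟩ := TopologicalSpace.Opens.mem_iSup.mp (hWD hy)
  exact ⟨j k, D k, hDW k, hD k, hk, c k, hc k, hw k⟩

/-- Locally on the base of a vector bundle, every line bundle on the total space is trivial. -/
theorem VectorBundleStructure.exists_isLinCoord {X : Scheme.{u}} [IsIntegral X]
    (hX : ∀ V : X.Opens, IsAffineOpen V → (V : Set X).Nonempty → IsIntegrallyClosed Γ(X, V))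
    {p : E ⟶ X} {z₀ : X ⟶ E} {r : ℕ} (B : VectorBundleStructure p z₀ r)
    (L : VectorBundleStructure q z 1) (x : X) :
    ∃ (i : B.ι) (V : X.Opens) (_ : V ≤ B.U i) (w : Γ(P, q ⁻¹ᵁ p ⁻¹ᵁ V)),
      x ∈ V ∧ L.IsLinCoord (p ⁻¹ᵁ V) w := by
  have := B.isIntegral
  obtain ⟨i, V₀, hi₀, hV₀, hxV₀, -⟩ := B.exists_affine_nhds x ⊤ trivial
  have hW₀ := (B.isChart_tRes i hi₀).isAffineOpen hV₀
  have hzx : p (z₀ x) = x := by simpa using congr($(B.zero_proj) x)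
  let S : Set Γ(E, p ⁻¹ᵁ V₀) := {b | b ≠ 0 ∧ ∃ j, E.basicOpen b ≤ L.U j}
  have hS : ∀ y ∈ p ⁻¹ᵁ V₀, ∃ b ∈ S, y ∈ E.basicOpen b := by
    intro y hy
    obtain ⟨j, hj⟩ := L.exists_mem_U y
    obtain ⟨b, hb, hyb⟩ := hW₀.exists_basicOpen_le (V := L.U j) ⟨y, hj⟩ hy
    refine ⟨b, ⟨?_, j, hb⟩, hyb⟩
    rintro rfl
    simp at hyb
  have hspan : Ideal.span S = ⊤ := by
    rw [← hW₀.self_le_iSup_basicOpen_iff]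
    intro y hy
    obtain ⟨b, hb, hyb⟩ := hS y hy
    exact TopologicalSpace.Opens.mem_iSup.mpr ⟨⟨b, hb⟩, hyb⟩
  obtain ⟨S', hS', hspan'⟩ := (Ideal.span_eq_top_iff_finite S).mp hspan
  -- `b₀` does not vanish at the origin over `x`. Inverting its restriction `a` to the zero section
  -- makes its constant coefficient a unit over `V`.
  obtain ⟨b₀, hb₀, hxb₀⟩ := hS (z₀ x) (by change p (z₀ x) ∈ V₀; rwa [hzx])
  let a : Γ(X, V₀) := pb z₀ (zero_preimage B.zero_proj V₀) b₀
  let V := X.basicOpen a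
  have hVV₀ : V ≤ V₀ := X.basicOpen_le a
  have hxV : x ∈ V :=
    (Scheme.basicOpen_appLE z₀ V₀ (p ⁻¹ᵁ V₀) (zero_preimage B.zero_proj V₀) b₀).ge ⟨hxV₀, hxb₀⟩
  have hVaff : IsAffineOpen V := hV₀.basicOpen a
  have hVne : (V : Set X).Nonempty := ⟨x, hxV⟩
  have : Nonempty V := ⟨⟨x, hxV⟩⟩
  have hi := hVV₀.trans hi₀
  have hWaff := (B.isChart_tRes i hi).isAffineOpen hVaff
  have hWne : ((p ⁻¹ᵁ V : E.Opens) : Set E).Nonempty := ⟨z₀ x, by simpa [hzx] using hxV⟩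
  have := hX V hVaff hVne
  let θ := RingEquiv.ofBijective _ ((B.isChart_tRes i hi).bijective_polyFun hVaff)
  -- `S'` alone gives a cover; `b₀` is added as the reference index.
  let κ : Type u := ↥(insert b₀ (S' : Set Γ(E, p ⁻¹ᵁ V₀)))
  have : Finite κ := Set.Finite.to_subtype (S'.finite_toSet.insert b₀)
  have hκ : ∀ k : κ, k.1 ∈ S := by
    rintro ⟨k, rfl | hk⟩
    · exact hb₀
    · exact hS' hk
  choose j hj using fun k : κ => (hκ k).2
  let e := p.preimage_mono hVV₀
  let b : κ → Γ(E, p ⁻¹ᵁ V) := fun k => res e k.1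
  have hDb : ∀ k, E.basicOpen (b k) = p ⁻¹ᵁ V ⊓ E.basicOpen k.1 := fun k =>
    Scheme.basicOpen_res E k.1 (homOfLE e).op
  have hb : ∀ k, b k ≠ 0 := by
    intro k hk
    refine (hκ k).1 (rat_injective _ (hWne.mono e) ?_)
    rw [← rat_res _ hWne e, map_zero]
    exact (congrArg (rat _ hWne) hk).trans (map_zero _)
  have hD : ∀ k, E.basicOpen (b k) ≤ L.U (j k) := fun k => by
    rw [hDb]; exact inf_le_right.trans (hj k)
  let k₀ : κ := ⟨b₀, Set.mem_insert _ _⟩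
  have hk₀ : IsUnit (MvPolynomial.constantCoeff (θ.symm (b k₀))) := by
    have h1 := pb_polyFun B.zero_proj (B.tRes i hi) (B.pb_zero_tRes i hi) (θ.symm (b k₀))
    rw [← h1]
    have h2 : polyFun p V (B.tRes i hi) (θ.symm (b k₀)) = b k₀ := θ.apply_symm_apply _
    rw [h2]
    have h3 := isUnit_res_basicOpen a
    simp only [a] at h3
    rw [res_pb] at h3
    simp only [b]
    rw [pb_res]
    exact h3
  obtain ⟨c, hc, hcc⟩ := L.exists_units hWaff θ b j hb hD k₀ hk₀
  obtain ⟨w, hw⟩ := L.exists_isLinCoord_of_units (fun k => E.basicOpen (b k))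
    (fun k => E.basicOpen_le _) (by
      intro y hy
      have h1 := (hW₀.self_le_iSup_basicOpen_iff (s := (S' : Set Γ(E, p ⁻¹ᵁ V₀)))).mpr hspan' (e hy)
      obtain ⟨⟨s, hs⟩, hys⟩ := TopologicalSpace.Opens.mem_iSup.mp h1
      refine TopologicalSpace.Opens.mem_iSup.mpr ⟨⟨s, Set.mem_insert_of_mem _ hs⟩, ?_⟩
      rw [hDb]
      exact ⟨hy, hys⟩) j hD c hc hcc
  exact ⟨i, V, hi, w, hxV, hw⟩

end LinCoord

/-! ### Normality of the base and the bundle of rank `r + 1` -/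

theorem isIntegrallyClosed_section {K : Type u} [Field K] {X : Scheme.{u}} (f : X ⟶ Spec (.of K))
    [Smooth f] [IsIntegral X] (V : X.Opens) (hV : IsAffineOpen V) (hne : (V : Set X).Nonempty) :
    IsIntegrallyClosed Γ(X, V) := by
  have : Nonempty V := ⟨⟨_, hne.some_mem⟩⟩
  have h := f.smooth_appLE (isAffineOpen_top (Spec (.of K))) hV (e := le_top)
  have h2 : ((Scheme.ΓSpecIso (.of K)).inv ≫ f.appLE ⊤ V le_top).hom.Smooth := by
    rw [CommRingCat.hom_comp]
    have hbij : Function.Bijective (Scheme.ΓSpecIso (.of K)).inv.hom :=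
      ConcreteCategory.bijective_of_isIso (Scheme.ΓSpecIso (.of K)).inv
    exact (RingHom.Smooth.of_bijective hbij).comp h
  let _ : Algebra K Γ(X, V) := ((Scheme.ΓSpecIso (.of K)).inv ≫ f.appLE ⊤ V le_top).hom.toAlgebra
  have : Algebra.Smooth K Γ(X, V) := h2
  exact isIntegrallyClosed_of_smooth K Γ(X, V)

theorem fin_snoc_eq {R : Type*} {r : ℕ} (t : Fin r → R) (w : R) :
    (Fin.snoc t w : Fin (r + 1) → R) =
      Sum.elim t (fun _ : Fin 1 => w) ∘ finSumFinEquiv.symm := by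
  funext k
  refine Fin.lastCases ?_ (fun k => ?_) k
  · rw [Fin.snoc_last, Function.comp_apply, show Fin.last r = Fin.natAdd r (0 : Fin 1) from rfl,
      finSumFinEquiv_symm_apply_natAdd]
    rfl
  · rw [Fin.snoc_castSucc, Function.comp_apply, show k.castSucc = Fin.castAdd 1 k from rfl,
      finSumFinEquiv_symm_apply_castAdd]
    rfl

/-- The invertible block diagonal matrix with blocks `G` and `c`. -/
def glSnoc {R : Type*} [CommRing R] {r : ℕ} (G : Matrix.GeneralLinearGroup (Fin r) R) (c : Rˣ) :
    Matrix.GeneralLinearGroup (Fin (r + 1)) R :=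
  Matrix.GeneralLinearGroup.mk'' (Matrix.reindex finSumFinEquiv finSumFinEquiv
      (Matrix.fromBlocks (G : Matrix (Fin r) (Fin r) R) 0 0 (Matrix.diagonal fun _ : Fin 1 => (c : R))))
    (by
      rw [Matrix.det_reindex_self, Matrix.det_fromBlocks_zero₂₁, Matrix.det_diagonal]
      simp)

theorem glSnoc_sum_castSucc {R S : Type*} [CommRing R] [CommRing S] {r : ℕ}
    (G : Matrix.GeneralLinearGroup (Fin r) R) (c : Rˣ) (φ : R →+* S) (t : Fin r → S) (w : S)
    (k : Fin r) : ∑ l, φ ((glSnoc G c : Matrix _ _ R) k.castSucc l) *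
      (Fin.snoc t w : Fin (r + 1) → S) l = ∑ l, φ ((G : Matrix _ _ R) k l) * t l := by
  rw [Fin.sum_univ_castSucc]
  have h1 : (glSnoc G c : Matrix _ _ R) k.castSucc (Fin.last r) = 0 := by
    change Matrix.fromBlocks _ _ _ _ (finSumFinEquiv.symm (Fin.castAdd 1 k))
      (finSumFinEquiv.symm (Fin.natAdd r (0 : Fin 1))) = 0
    simp
  have h2 : ∀ l : Fin r, (glSnoc G c : Matrix _ _ R) k.castSucc l.castSucc =
      (G : Matrix _ _ R) k l := by
    intro l
    change Matrix.fromBlocks _ _ _ _ (finSumFinEquiv.symm (Fin.castAdd 1 k))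
      (finSumFinEquiv.symm (Fin.castAdd 1 l)) = _
    simp
  simp [h1, h2]

theorem glSnoc_sum_last {R S : Type*} [CommRing R] [CommRing S] {r : ℕ}
    (G : Matrix.GeneralLinearGroup (Fin r) R) (c : Rˣ) (φ : R →+* S) (t : Fin r → S) (w : S) :
    ∑ l, φ ((glSnoc G c : Matrix _ _ R) (Fin.last r) l) *
      (Fin.snoc t w : Fin (r + 1) → S) l = φ c * w := by
  rw [Fin.sum_univ_castSucc]
  have h1 : (glSnoc G c : Matrix _ _ R) (Fin.last r) (Fin.last r) = c := by
    change Matrix.fromBlocks _ _ _ _ (finSumFinEquiv.symm (Fin.natAdd r (0 : Fin 1)))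
      (finSumFinEquiv.symm (Fin.natAdd r (0 : Fin 1))) = _
    simp
  have h2 : ∀ l : Fin r, (glSnoc G c : Matrix _ _ R) (Fin.last r) l.castSucc = 0 := by
    intro l
    change Matrix.fromBlocks _ _ _ _ (finSumFinEquiv.symm (Fin.natAdd r (0 : Fin 1)))
      (finSumFinEquiv.symm (Fin.castAdd 1 l)) = _
    simp
  simp [h1, h2]

/-- A line bundle over the total space of a vector bundle of rank `r` over an integral normal
scheme is a vector bundle of rank `r + 1`. -/
theorem VectorBundleStructure.nonempty_comp {X E P : Scheme.{u}} [IsIntegral X]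
    (hX : ∀ V : X.Opens, IsAffineOpen V → (V : Set X).Nonempty → IsIntegrallyClosed Γ(X, V))
    {p : E ⟶ X} {z : X ⟶ E} {q : P ⟶ E} {z' : E ⟶ P} {r : ℕ} (B : VectorBundleStructure p z r)
    (L : VectorBundleStructure q z' 1) :
    Nonempty (VectorBundleStructure (q ≫ p) (z ≫ z') (r + 1)) := by
  choose i V hi w₀ hxV hw₀ using fun x => B.exists_isLinCoord hX L x
  obtain ⟨w, hw⟩ : ∃ w : ∀ x, Γ(P, (q ≫ p) ⁻¹ᵁ V x), ∀ x, L.IsLinCoord (p ⁻¹ᵁ V x) (w x) :=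
    ⟨w₀, hw₀⟩
  let t : ∀ x, Fin r → Γ(P, (q ≫ p) ⁻¹ᵁ V x) := fun x k =>
    pb q (le_refl (q ⁻¹ᵁ p ⁻¹ᵁ V x)) (res (p.preimage_mono (hi x)) (B.t (i x) k))
  have hc : ∀ x y, ∃ c : Γ(X, V x ⊓ V y), IsUnit c ∧
      res ((q ≫ p).preimage_mono (inf_le_right : V x ⊓ V y ≤ V y)) (w y) =
        pb (q ≫ p) le_rfl c * res ((q ≫ p).preimage_mono (inf_le_left : V x ⊓ V y ≤ V x)) (w x) := by
    intro x y
    have h1 := (hw x).restrict (p.preimage_mono (inf_le_left : V x ⊓ V y ≤ V x))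
    have h2 := (hw y).restrict (p.preimage_mono (inf_le_right : V x ⊓ V y ≤ V y))
    obtain ⟨u, hu, hwu⟩ := h1.exists_unit h2
    -- The factor `u` lives on `E`, but transition matrices need entries on `X`; invertibility of
    -- `u` makes it descend.
    obtain ⟨c, hc, rfl⟩ := B.eq_pb_of_isUnit u hu
    refine ⟨c, hc, hwu.trans ?_⟩
    congr 1
    exact pb_pb q p le_rfl le_rfl c
  choose c hcu hc using hc
  have hz : (z ≫ z') ≫ q ≫ p = 𝟙 X := by
    rw [Category.assoc, reassoc_of% L.zero_proj, B.zero_proj]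
  refine ⟨ofCharts hz V ?_ (fun x => Fin.snoc (t x) (w x)) ?_
    (fun x y => glSnoc ((B.g (i x) (i y)).map
      (res (inf_le_inf (hi x) (hi y)))) (hcu x y).unit) ?_ ?_⟩
  · exact top_le_iff.mp fun x _ => TopologicalSpace.Opens.mem_iSup.mpr ⟨x, hxV x⟩
  · intro x
    have h1 := (hw x).isChart.comp ((B.isChart (i x)).restrict (hi x))
    have h2 := h1.reindex finSumFinEquiv.symm
    rw [fin_snoc_eq]
    exact h2
  · intro x y k
    have hsn : ∀ l, res ((q ≫ p).preimage_mono (inf_le_left : V x ⊓ V y ≤ V x))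
        ((Fin.snoc (t x) (w x) : Fin (r + 1) → _) l) =
        (Fin.snoc (fun l => res ((q ≫ p).preimage_mono (inf_le_left : V x ⊓ V y ≤ V x)) (t x l))
          (res ((q ≫ p).preimage_mono (inf_le_left : V x ⊓ V y ≤ V x)) (w x)) :
          Fin (r + 1) → _) l := by
      intro l
      refine Fin.lastCases ?_ (fun l => ?_) l
      · rw [Fin.snoc_last, Fin.snoc_last]
      · rw [Fin.snoc_castSucc, Fin.snoc_castSucc]
    simp only [hsn]
    refine Fin.lastCases ?_ (fun k => ?_) k
    · rw [Fin.snoc_last, glSnoc_sum_last]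
      exact hc x y
    · rw [Fin.snoc_castSucc, glSnoc_sum_castSucc]
      have h := congrArg (res (p.preimage_mono (inf_le_inf (hi x) (hi y))))
        (B.res_t (i x) (i y) k)
      rw [map_sum] at h
      have h' := congrArg (pb q (le_refl (q ⁻¹ᵁ p ⁻¹ᵁ (V x ⊓ V y)))) h
      rw [res_res, pb_res, map_sum] at h'
      have e1 : res ((q ≫ p).preimage_mono (inf_le_right : V x ⊓ V y ≤ V y)) (t y k) =
          pb q _ (B.t (i y) k) := (res_pb q _ _ _).trans (pb_res q _ _ _)
      refine e1.trans (h'.trans (Finset.sum_congr rfl fun l _ => ?_))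
      have e2 : res ((q ≫ p).preimage_mono (inf_le_left : V x ⊓ V y ≤ V x)) (t x l) =
          pb q _ (B.t (i x) l) := (res_pb q _ _ _).trans (pb_res q _ _ _)
      rw [map_mul, map_mul, pb_res, res_res, pb_res, e2]
      congr 1
      refine (pb_pb q p _ _ _).trans ?_
      exact (pb_res (q ≫ p) _ _ _).symm
  · intro x k
    refine Fin.lastCases ?_ (fun k => ?_) k
    · rw [Fin.snoc_last]
      exact (pb_pb z z' (zero_preimage L.zero_proj (p ⁻¹ᵁ V x)) (zero_preimage B.zero_proj (V x))
        (w x)).symm.trans (by rw [(hw x).pb_zero, map_zero])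
    · rw [Fin.snoc_castSucc]
      refine (pb_pb (z ≫ z') q _ _ _).trans ?_
      rw [pb_res]
      refine (pb_congr (show (z ≫ z') ≫ q = z by
        rw [Category.assoc, L.zero_proj, Category.comp_id]) _ _).trans ?_
      exact B.pb_zero_t _ _ _

/-! ### The chain rule -/

namespace KPoint

variable {K : Type u} [Field K] {X Y Z : Scheme.{u}} {fX : X ⟶ Spec (.of K)}
  {fY : Y ⟶ Spec (.of K)} {fZ : Z ⟶ Spec (.of K)}

theorem pullbackGerm_comp (w : KPoint fZ) (y : KPoint fY) (x : KPoint fX) (h : Z ⟶ Y) (g : Y ⟶ X)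
    (hh : w.hom ≫ h = y.hom) (hg : y.hom ≫ g = x.hom) (hgh : w.hom ≫ h ≫ g = x.hom)
    (a : x.LocalRing) : pullbackGerm w x (h ≫ g) hgh a =
      pullbackGerm w y h hh (pullbackGerm y x g hg a) := by
  obtain ⟨x, hx⟩ := x
  obtain ⟨y, hy⟩ := y
  change w.hom ≫ h = y at hh
  subst hh
  change (w.hom ≫ h) ≫ g = x at hg
  subst hg
  have e : X.presheaf.stalkSpecializes (x := g (h w.pt)) (y := g (h w.pt)) specializes_rfl ≫
      (h ≫ g).stalkMap w.pt =
      (X.presheaf.stalkSpecializes (x := g (h w.pt)) (y := g (h w.pt)) specializes_rfl ≫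
        g.stalkMap (h w.pt)) ≫
      Y.presheaf.stalkSpecializes (x := h w.pt) (y := h w.pt) specializes_rfl ≫
        h.stalkMap w.pt := by
    rw [TopCat.Presheaf.stalkSpecializes_refl, TopCat.Presheaf.stalkSpecializes_refl]
    refine (Category.id_comp _).trans ?_
    refine (Scheme.Hom.stalkMap_comp h g w.pt).trans ?_
    refine congr (congrArg _ (Category.id_comp _).symm) (Category.id_comp _).symm
  exact congrArg (fun φ => φ.hom a) e

theorem differential_comp (w : KPoint fZ) (y : KPoint fY) (x : KPoint fX) (h : Z ⟶ Y) (g : Y ⟶ X)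
    (hh : w.hom ≫ h = y.hom) (hg : y.hom ≫ g = x.hom) (hgh : w.hom ≫ h ≫ g = x.hom)
    (hhK : h ≫ fY = fZ) (hgK : g ≫ fX = fY) (hghK : (h ≫ g) ≫ fX = fZ) (D : w.TangentSpace) :
    differential w x (h ≫ g) hgh hghK D =
      differential y x g hg hgK (differential w y h hh hhK D) := by
  refine Derivation.ext fun a => ?_
  exact congrArg D (pullbackGerm_comp w y x h g hh hg hgh a)

theorem range_differential_le (w : KPoint fZ) (y : KPoint fY) (x : KPoint fX) (h : Z ⟶ Y)
    (g : Y ⟶ X) (k : Z ⟶ X) (hk : h ≫ g = k) (hh : w.hom ≫ h = y.hom) (hg : y.hom ≫ g = x.hom)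
    (hkp : w.hom ≫ k = x.hom) (hhK : h ≫ fY = fZ) (hgK : g ≫ fX = fY) (hkK : k ≫ fX = fZ) :
    LinearMap.range (differential w x k hkp hkK) ≤ LinearMap.range (differential y x g hg hgK) := by
  subst hk
  rintro _ ⟨D, rfl⟩
  exact ⟨_, (differential_comp w y x h g hh hg hkp hhK hgK hkK D).symm⟩

end KPoint

/-! ### Compositions of sprays -/

namespace Triple

variable {K : Type u} [Field K] {X : Scheme.{u}} {f : X ⟶ Spec (.of K)}

/-- The zero section `e₁ ↦ (e₁, 0₂(s₁ e₁))` of `E₁ * E₂` over `E₁`. -/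
def inl (S₁ S₂ : Triple f) : S₁.E ⟶ pullback S₁.s S₂.p :=
  pullback.lift (𝟙 _) (S₁.s ≫ S₂.zero)
    (by rw [Category.id_comp, Category.assoc, S₂.zero_p, Category.comp_id])

theorem inl_fst (S₁ S₂ : Triple f) : S₁.inl S₂ ≫ pullback.fst S₁.s S₂.p = 𝟙 _ :=
  pullback.lift_fst _ _ _

theorem inl_snd (S₁ S₂ : Triple f) :
    S₁.inl S₂ ≫ pullback.snd S₁.s S₂.p = S₁.s ≫ S₂.zero :=
  pullback.lift_snd _ _ _

theorem inl_p (S₁ S₂ : Triple f) : S₁.inl S₂ ≫ (S₁.comp S₂).p = S₁.p :=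
  (Category.assoc _ _ _).symm.trans
    ((congrArg (· ≫ S₁.p) (S₁.inl_fst S₂)).trans (Category.id_comp _))

theorem inl_s (S₁ S₂ : Triple f) : S₁.inl S₂ ≫ (S₁.comp S₂).s = S₁.s := by
  refine (Category.assoc _ _ _).symm.trans ((congrArg (· ≫ S₂.s) (S₁.inl_snd S₂)).trans ?_)
  rw [Category.assoc, S₂.zero_s, S₂.zero_p, Category.comp_id]

theorem zero_inl (S₁ S₂ : Triple f) : S₁.zero ≫ S₁.inl S₂ = (S₁.comp S₂).zero := by
  refine pullback.hom_ext (Eq.trans ?_ (pullback.lift_fst _ _ _).symm)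
    (Eq.trans ?_ (pullback.lift_snd _ _ _).symm)
  · rw [Category.assoc, inl_fst, Category.comp_id]
  · rw [Category.assoc, inl_snd, ← Category.assoc, S₁.zero_s, S₁.zero_p, Category.id_comp]

/-- The map `e₂ ↦ (0₁(p₂ e₂), e₂)` from `E₂` to `E₁ * E₂`. -/
def inr (S₁ S₂ : Triple f) : S₂.E ⟶ pullback S₁.s S₂.p :=
  pullback.lift (S₂.p ≫ S₁.zero) (𝟙 _)
    (by rw [Category.id_comp, Category.assoc, S₁.zero_s, S₁.zero_p, Category.comp_id])

theorem inr_fst (S₁ S₂ : Triple f) :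
    S₁.inr S₂ ≫ pullback.fst S₁.s S₂.p = S₂.p ≫ S₁.zero :=
  pullback.lift_fst _ _ _

theorem inr_snd (S₁ S₂ : Triple f) : S₁.inr S₂ ≫ pullback.snd S₁.s S₂.p = 𝟙 _ :=
  pullback.lift_snd _ _ _

theorem inr_p (S₁ S₂ : Triple f) : S₁.inr S₂ ≫ (S₁.comp S₂).p = S₂.p := by
  refine (Category.assoc _ _ _).symm.trans ((congrArg (· ≫ S₁.p) (S₁.inr_fst S₂)).trans ?_)
  rw [Category.assoc, S₁.zero_p, Category.comp_id]

theorem inr_s (S₁ S₂ : Triple f) : S₁.inr S₂ ≫ (S₁.comp S₂).s = S₂.s :=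
  (Category.assoc _ _ _).symm.trans
    ((congrArg (· ≫ S₂.s) (S₁.inr_snd S₂)).trans (Category.id_comp _))

theorem zero_inr (S₁ S₂ : Triple f) : S₂.zero ≫ S₁.inr S₂ = (S₁.comp S₂).zero := by
  refine pullback.hom_ext (Eq.trans ?_ (pullback.lift_fst _ _ _).symm)
    (Eq.trans ?_ (pullback.lift_snd _ _ _).symm)
  · rw [Category.assoc, inr_fst, ← Category.assoc, S₂.zero_p, Category.id_comp]
  · rw [Category.assoc, inr_snd, Category.comp_id]

/-- A morphism of triples restricts to the fibres over `x`, preserving origins and spray maps, so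
the chain rule factors one differential through the other. -/
theorem range_fibreDifferential_le (S T : Triple f) (j : S.E ⟶ T.E) (hp : j ≫ T.p = S.p)
    (hs : j ≫ T.s = S.s) (hz : S.zero ≫ j = T.zero) (x : KPoint f) :
    LinearMap.range (S.fibreDifferential x) ≤ LinearMap.range (T.fibreDifferential x) := by
  let h : S.fibre x ⟶ T.fibre x := pullback.lift (pullback.fst S.p x.hom ≫ j)
    (pullback.snd S.p x.hom) (by rw [Category.assoc, hp, pullback.condition])
  have h1 : h ≫ pullback.fst T.p x.hom = pullback.fst S.p x.hom ≫ j := pullback.lift_fst _ _ _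
  have h2 : h ≫ pullback.snd T.p x.hom = pullback.snd S.p x.hom := pullback.lift_snd _ _ _
  have o1 : (S.origin x).hom ≫ pullback.fst S.p x.hom = x.hom ≫ S.zero := pullback.lift_fst _ _ _
  have o2 : (S.origin x).hom ≫ pullback.snd S.p x.hom = 𝟙 _ := pullback.lift_snd _ _ _
  refine KPoint.range_differential_le (S.origin x) (T.origin x) x h (T.fibreMap x) (S.fibreMap x)
    ?_ ?_ _ _ h2 _ _
  · change h ≫ pullback.fst T.p x.hom ≫ T.s = pullback.fst S.p x.hom ≫ S.s
    rw [← Category.assoc, h1, Category.assoc, hs]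
  · apply pullback.hom_ext
    · rw [Category.assoc, h1, ← Category.assoc, o1, Category.assoc, hz]
      exact (pullback.lift_fst _ _ _).symm
    · rw [Category.assoc, h2, o2]
      exact (pullback.lift_snd _ _ _).symm

theorem iSup_range_le_iterComp (x : KPoint f) : ∀ (m : ℕ) (S : Fin m → Triple f),
    ⨆ i, LinearMap.range ((S i).fibreDifferential x) ≤
      LinearMap.range ((iterComp m S).fibreDifferential x)
  | 0, _ => iSup_le fun i => i.elim0
  | 1, S => iSup_le fun i => by
    rw [Subsingleton.elim i 0]
    exact le_rfl
  | m + 2, S => iSup_le fun i => by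
    let T := iterComp (m + 1) fun i => S i.castSucc
    -- The last factor embeds through `inr`; the others reach the composition through the shorter
    -- composition and `inl`.
    refine Fin.lastCases ?_ (fun i => ?_) i
    · exact range_fibreDifferential_le _ _ (T.inr _) (inr_p _ _) (inr_s _ _) (zero_inr _ _) x
    · exact (le_iSup (fun i : Fin (m + 1) => LinearMap.range
        ((S i.castSucc).fibreDifferential x)) i).trans ((iSup_range_le_iterComp x (m + 1) _).trans
          (range_fibreDifferential_le T _ (T.inl _) (inl_p _ _) (inl_s _ _) (zero_inl _ _) x))

theorem IsDominatingFamily.iterComp {m : ℕ} {S : Fin m → Triple f} (h : IsDominatingFamily S) :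
    (iterComp m S).IsDominating := fun x =>
  LinearMap.range_eq_top.mp (top_le_iff.mp ((h x).ge.trans (iSup_range_le_iterComp x m S)))

theorem isSpray_unit : (unit f).IsSpray 0 :=
  ⟨VectorBundleStructure.ofCharts (Category.comp_id _) (ι := PUnit) (fun _ => ⊤)
    (by simp) (fun _ => Fin.elim0)
    (fun _ => ⟨fun a _ _ => ⟨a, le_top, Category.comp_id _, fun k => k.elim0⟩,
      fun b b' _ _ h _ => (Category.comp_id b).symm.trans (h.trans (Category.comp_id b'))⟩)
    (fun _ _ => 1) (fun _ _ k => k.elim0) (fun _ k => k.elim0)⟩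

variable [IsIntegral X] [Smooth f]

/-- The composition of a spray of rank `r` and a spray of rank one is a spray of rank `r + 1`. -/
theorem IsSpray.comp {r : ℕ} {S₁ S₂ : Triple f} (h₁ : S₁.IsSpray r) (h₂ : S₂.IsSpray 1) :
    (S₁.comp S₂).IsSpray (r + 1) := by
  obtain ⟨B⟩ := h₁
  obtain ⟨L⟩ := h₂
  -- `E₁ * E₂ → E₁` is the base change of `E₂ → X` along `s₁`, with zero section `inl`; following
  -- the zero section of `E₁` by it gives the distinguished section.
  have h := B.nonempty_comp (isIntegrallyClosed_section f)
    (L.baseChange (IsPullback.of_hasPullback S₁.s S₂.p).flip (S₁.inl_fst S₂) (S₁.inl_snd S₂))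
  rwa [zero_inl] at h

theorem IsSpray.iterComp : ∀ (m : ℕ) (S : Fin m → Triple f), (∀ i, (S i).IsSpray 1) →
    (iterComp m S).IsSpray m
  | 0, _, _ => isSpray_unit
  | 1, _, h => h 0
  | m + 2, S, h => (IsSpray.iterComp (m + 1) (fun i => S i.castSucc) fun i => h i.castSucc).comp
      (h (Fin.last (m + 1)))

end Triple

end AlgSpray

end

theorem mainTheorem4 {K : Type u} [Field K] [IsAlgClosed K] [CharZero K]
    {X : Scheme.{u}} (f : X ⟶ Spec (.of K))
    [IsIntegral X] [IsSeparated f] [LocallyOfFiniteType f] [QuasiCompact f] [Smooth f] :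
    (∀ (r : ℕ) (S₁ S₂ : AlgSpray.Triple f), S₁.IsSpray r → S₂.IsSpray 1 →
      (S₁.comp S₂).IsSpray (r + 1)) ∧
    (∀ (r : ℕ) (L : Fin r → AlgSpray.Triple f), (∀ i, (L i).IsSpray 1) →
      (AlgSpray.Triple.iterComp r L).IsSpray r ∧
      (AlgSpray.Triple.IsDominatingFamily L →
        (AlgSpray.Triple.iterComp r L).IsDominating)) :=
  ⟨fun _ _ _ h₁ h₂ => h₁.comp h₂, fun r L hL =>
    ⟨AlgSpray.Triple.IsSpray.iterComp r L hL, fun h => h.iterComp⟩⟩
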